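/- **Definitions.** A marked linkage $\mathcal L=(L,\ell,W)$ is a finite graph $L$ without loops, with a positive length $\ell[vw]$ for each edge and an ordered set $W=(w_1,\dots,w_s)$ of fixed vertices. For $Z\in\mathbb C^s$, let $C(\mathcal L,Z)$ be the set of maps $\phi$ from the vertices to $\mathbb C$ with $|\phi(v)-\phi(w)|^2=\ell[vw]^2$ for all edges and $\phi(w_j)=Z_j$ for all $j$; it is the set of real points of the affine scheme $\mathfrak C(\mathcal L,Z)$ defined by these equations together with $\ell[AC]\,\phi(B)=\ell[BC]\,\phi(A)+\ell[AB]\,\phi(C)$ for all degenerate triangles ($\ell[AC]=\ell[AB]+\ell[BC]$) of $L$. $(\mathcal L,Z)$ with input vertices $P_1,\dots,P_m$ and output vertices $Q_1,\dots,Q_n$ is a *$\mathbb C$-functional linkage* for a germ $(F,O)$, where $F:\mathbb C^m\to\mathbb C^n$ is a map and $O\in\mathbb C^m$, if (1) the input map $p(\phi)=(\phi(P_i))_i$ is a regular topological branched covering of a set with nonempty interior in $\mathbb C^m$, whose group is a finite group of scheme-theoretic automorphisms of $\mathfrak C(\mathcal L,Z)$ (that is, $p$ identifies its image with the quotient of $C(\mathcal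 L,Z)$ by this group, and nontrivial elements have nowhere dense fixed point sets); $O=p(\phi)$ for some $\phi$ at which $p:\mathfrak C(\mathcal L,Z)\to\mathbb C^m$ is, scheme-theoretically, a local analytic isomorphism; and (2) the output map satisfies $(\phi(Q_j))_j=F(p(\phi))$ for all $\phi\in C(\mathcal L,Z)$. A *closed $\mathbb C$-functional linkage* is obtained from a $\mathbb C$-functional linkage by identifying each vertex of some nonempty set of output vertices with a fixed vertex; its input map is the restriction of $p$. **Theorem.** Let $f=f(z,\bar z)$ be a polynomial in $z,\bar z$ with real values on $\mathbb C$, let $\Gamma=f^{-1}(0)\subset\mathbb C$, and let $U\subset\Gamma$ be bounded and open in $\Gamma$ for the classical topology. Then there is a closed $\mathbb C$-functional linkage $(\mathcal L_0,Z)$ with one input vertex $P$ whose input map $p_0:C(\mathcal L_0,Z)\to\mathbb C$, $p_0(\phi)=\phi(P)$, is an analytically trivial polynomial covering over $U$. That is: $p_0$ takes values in $\Gamma$; $p_0^{-1}(U)$ is a disjoint union of finitely many (at least one) relatively open sheets, each of which is mapped by $p_0$ analytically isomorphically onto $U$; and there is a finite group of polynomial automorphisms $\sigma$ of the real algebraic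 set $C(\mathcal L_0,Z)$ with $p_0\circ\sigma=p_0$ which acts simply transitively on each fiber of $p_0$ over a point of $U$. -/

import Mathlib

open Filter Topology

/-! ### Marked linkages and their relative configuration spaces -/

/-- An abstract marked linkage on the vertex set `V`: a graph without loops, a positive length for
each edge, and an ordered set of `s` distinct fixed vertices. The values of `len` off the edge set
play no role. -/
structure MarkedLinkage (V : Type) (s : ℕ) where
  graph : SimpleGraph V
  len : Sym2 V → ℝ
  len_pos : ∀ e ∈ graph.edgeSet, 0 < len e
  mark : Fin s ↪ V

/-- The real coordinates `(x_v, y_v)` of a map from the vertices to the plane. -/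
def realCoord {V : Type} (φ : V → ℂ) : V × Fin 2 → ℝ :=
  fun c => ![(φ c.1).re, (φ c.1).im] c.2

/-- The forgetful map recording the positions of the vertices `P i`. -/
def positions {V : Type} {m : ℕ} (P : Fin m → V) (φ : V → ℂ) : Fin m → ℂ :=
  fun i => φ (P i)

namespace MarkedLinkage

/-- The relative configuration space `C(L, Z)`: planar realizations of the linkage which send the
`j`-th fixed vertex to `Z j`. -/
def config {V : Type} {s : ℕ} (L : MarkedLinkage V s) (Z : Fin s → ℂ) : Set (V → ℂ) :=
  {φ | (∀ v w, L.graph.Adj v w → ‖φ v - φ w‖ ^ 2 = L.len s(v, w) ^ 2) ∧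
    ∀ j, φ (L.mark j) = Z j}

/-! ### The configuration scheme -/

/-- The equation of the edge `[v w]`. -/
noncomputable def edgeEq {V : Type} {s : ℕ} (L : MarkedLinkage V s) (v w : V) :
    MvPolynomial (V × Fin 2) ℝ :=
  (MvPolynomial.X (v, 0) - MvPolynomial.X (w, 0)) ^ 2 +
    (MvPolynomial.X (v, 1) - MvPolynomial.X (w, 1)) ^ 2 -
    MvPolynomial.C (L.len s(v, w) ^ 2)

/-- The `i`-th coordinate of the equation `φ (mark j) = Z j`. -/
noncomputable def markEq {V : Type} {s : ℕ} (L : MarkedLinkage V s) (Z : Fin s → ℂ)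
    (j : Fin s) (i : Fin 2) : MvPolynomial (V × Fin 2) ℝ :=
  MvPolynomial.X (L.mark j, i) - MvPolynomial.C (![(Z j).re, (Z j).im] i)

/-- A degenerate triangle: `a, b, c` are pairwise joined by edges and the length of `[a c]` is the
sum of the lengths of `[a b]` and `[b c]`. -/
def IsDegenerateTriangle {V : Type} {s : ℕ} (L : MarkedLinkage V s) (a b c : V) : Prop :=
  L.graph.Adj a b ∧ L.graph.Adj b c ∧ L.graph.Adj a c ∧
    L.len s(a, c) = L.len s(a, b) + L.len s(b, c)

/-- For a degenerate triangle, the `i`-th coordinate of the equation (multiplied by the length of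
`[a c]`) saying that `b` is the point of the bar `[a c]` at the prescribed distances from
`a` and `c`. -/
noncomputable def barEq {V : Type} {s : ℕ} (L : MarkedLinkage V s) (a b c : V) (i : Fin 2) :
    MvPolynomial (V × Fin 2) ℝ :=
  MvPolynomial.C (L.len s(a, c)) * MvPolynomial.X (b, i) -
    (MvPolynomial.C (L.len s(b, c)) * MvPolynomial.X (a, i) +
      MvPolynomial.C (L.len s(a, b)) * MvPolynomial.X (c, i))

/-- The ideal of the configuration scheme. For a degenerate triangle `a b c` the linear equations
`barEq` are imposed; together with the equation of `[a c]` they imply those of `[a b]` and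
`[b c]`. -/
noncomputable def ideal {V : Type} {s : ℕ} (L : MarkedLinkage V s) (Z : Fin s → ℂ) :
    Ideal (MvPolynomial (V × Fin 2) ℝ) :=
  Ideal.span
    ({q | ∃ v w, L.graph.Adj v w ∧ q = L.edgeEq v w} ∪
      {q | ∃ j i, q = L.markEq Z j i} ∪
      {q | ∃ a b c i, L.IsDegenerateTriangle a b c ∧ q = L.barEq a b c i})

/-- A self-map of the configuration space is a scheme-theoretic automorphism if it is induced by an
automorphism `e` of the coordinate ring of the configuration scheme: `e` sends (the class of) a
polynomial `q` to (the class of) a polynomial `r` only if `r = q ∘ σ` on real points. -/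
def IsSchemeAutomorphism {V : Type} {s : ℕ} (L : MarkedLinkage V s) (Z : Fin s → ℂ)
    (σ : Equiv.Perm (L.config Z)) : Prop :=
  ∃ e : (MvPolynomial (V × Fin 2) ℝ ⧸ L.ideal Z) ≃ₐ[ℝ] (MvPolynomial (V × Fin 2) ℝ ⧸ L.ideal Z),
    ∀ q r : MvPolynomial (V × Fin 2) ℝ,
      e (Ideal.Quotient.mk (L.ideal Z) q) = Ideal.Quotient.mk (L.ideal Z) r →
      ∀ φ : L.config Z,
        MvPolynomial.eval (realCoord (σ φ : V → ℂ)) q =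
          MvPolynomial.eval (realCoord (φ : V → ℂ)) r

/-- The germ at `φ` of the function `u` belongs to the ideal generated by the configuration ideal in
the ring of germs at `φ` of real-analytic functions. -/
def InAnalyticIdeal {V : Type} [Fintype V] {s : ℕ} (L : MarkedLinkage V s) (Z : Fin s → ℂ)
    (φ : V → ℂ) (u : (V → ℂ) → ℝ) : Prop :=
  ∃ (t : Finset (MvPolynomial (V × Fin 2) ℝ))
    (h : MvPolynomial (V × Fin 2) ℝ → (V → ℂ) → ℝ),
    (∀ q ∈ t, q ∈ L.ideal Z) ∧ (∀ q ∈ t, AnalyticAt ℝ (h q) φ) ∧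
    ∀ᶠ ψ in 𝓝 φ, u ψ = ∑ q ∈ t, h q ψ * MvPolynomial.eval (realCoord ψ) q

/-- `φ` is a regular point of the input morphism `p` if `p` is, in the scheme-theoretic sense, a
local analytic isomorphism at `φ` from the configuration scheme to `ℂ ^ m`. That is, `p` has an
inverse morphism of germs of (possibly nonreduced) analytic spaces: an analytic germ `g` from
`ℂ ^ m` into the configuration space with `p ∘ g = id`, such that `g ∘ p` agrees with the identity
modulo the analytic ideal of the configuration scheme. -/
def IsRegularPoint {V : Type} [Fintype V] {s : ℕ} (L : MarkedLinkage V s) (Z : Fin s → ℂ)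
    {m : ℕ} (P : Fin m → V) (φ : V → ℂ) : Prop :=
  φ ∈ L.config Z ∧
  ∃ g : (Fin m → ℂ) → (V → ℂ),
    AnalyticAt ℝ g (positions P φ) ∧ g (positions P φ) = φ ∧
    (∀ᶠ z in 𝓝 (positions P φ), g z ∈ L.config Z ∧ positions P (g z) = z) ∧
    ∀ c : V × Fin 2,
      L.InAnalyticIdeal Z φ (fun ψ => realCoord ψ c - realCoord (g (positions P ψ)) c)

/-! ### Functional linkages -/

/-- The input map is a regular topological branched covering of its image with the finite group `G`
of automorphisms: it identifies its image with the quotient of the configuration space by `G`, and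
nontrivial elements of `G` have nowhere dense fixed point sets. (Hence it is a covering with group
`G` away from the images of these sets.) Moreover, `G` consists of scheme-theoretic
automorphisms. -/
structure IsRegularBranchedCovering {V : Type} {s : ℕ} (L : MarkedLinkage V s)
    (Z : Fin s → ℂ) {m : ℕ} (P : Fin m → V) (G : Subgroup (Equiv.Perm (L.config Z))) : Prop where
  finite : Finite G
  scheme : ∀ σ ∈ G, L.IsSchemeAutomorphism Z σ
  fibers : ∀ φ ψ : L.config Z,
    positions P (φ : V → ℂ) = positions P (ψ : V → ℂ) ↔ ∃ σ ∈ G, σ φ = ψ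
  quotient : IsQuotientMap
    (Set.rangeFactorization fun φ : L.config Z => positions P (φ : V → ℂ))
  walls : ∀ σ ∈ G, σ ≠ 1 → IsNowhereDense {φ : L.config Z | σ φ = φ}

/-- `L`, with the image `Z` of the marking, input vertices `P` and output vertices `Q`, is a
`ℂ`-functional linkage for the germ `(F, O)`. -/
structure IsFunctionalFor {V : Type} [Fintype V] {s : ℕ} (L : MarkedLinkage V s)
    (Z : Fin s → ℂ) {m n : ℕ} (P : Fin m → V) (Q : Fin n → V)
    (F : (Fin m → ℂ) → (Fin n → ℂ)) (O : Fin m → ℂ) : Prop where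
  domain : (interior (positions P '' L.config Z)).Nonempty
  covering : ∃ G : Subgroup (Equiv.Perm (L.config Z)), L.IsRegularBranchedCovering Z P G
  regular : ∃ φ, L.IsRegularPoint Z P φ ∧ positions P φ = O
  output : ∀ φ ∈ L.config Z, positions Q φ = F (positions P φ)

/-- `(L₀, Z₀)` is the self-fiber sum of `(L, Z)` along the map `β` defined on the set `S` of
vertices, with quotient map `π`: each `v ∈ S` is identified with `β v`, the edges with their lengths
are the images of the edges of `L`, and the fixed vertices with their prescribed positions are the
images of the fixed vertices of `L`. -/
structure IsSelfFiberSum {V V₀ : Type} {s s₀ : ℕ} (L : MarkedLinkage V s) (Z : Fin s → ℂ)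
    (S : Set V) (β : V → V) (L₀ : MarkedLinkage V₀ s₀) (Z₀ : Fin s₀ → ℂ) (π : V → V₀) : Prop where
  surjective : Function.Surjective π
  identify : ∀ v w, π v = π w ↔ Relation.EqvGen (fun a b => a ∈ S ∧ b = β a) v w
  adj : ∀ x y, L₀.graph.Adj x y ↔ ∃ v w, L.graph.Adj v w ∧ π v = x ∧ π w = y
  len : ∀ v w, L.graph.Adj v w → L₀.len s(π v, π w) = L.len s(v, w)
  mark : Set.range L₀.mark = π '' Set.range L.mark
  image : ∀ i j, L₀.mark j = π (L.mark i) → Z₀ j = Z i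

/-- `(L₀, Z₀)` with input vertices `P₀` is a closed `ℂ`-functional linkage: it arises from a
`ℂ`-functional linkage by gluing some of its output vertices to fixed vertices. -/
def IsClosedFunctional {V₀ : Type} {s₀ : ℕ} (L₀ : MarkedLinkage V₀ s₀) (Z₀ : Fin s₀ → ℂ)
    {m : ℕ} (P₀ : Fin m → V₀) : Prop :=
  ∃ (V : Type) (_ : Fintype V) (s n : ℕ) (L : MarkedLinkage V s) (Z : Fin s → ℂ)
    (P : Fin m → V) (Q : Fin n → V) (F : (Fin m → ℂ) → (Fin n → ℂ)) (O : Fin m → ℂ)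
    (S : Set V) (β : V → V) (π : V → V₀),
    L.IsFunctionalFor Z P Q F O ∧
    S.Nonempty ∧ S ⊆ Set.range Q ∧ Set.MapsTo β S (Set.range L.mark) ∧
    L.IsSelfFiberSum Z S β L₀ Z₀ π ∧ P₀ = π ∘ P

end MarkedLinkage

/-! ### Analytically trivial polynomial coverings -/

/-- `f` is analytic on an arbitrary subset `A`: near each point of `A` it agrees on `A` with a
real-analytic map defined on a neighbourhood in the ambient space. -/
def IsAnalyticOnSubset {E F : Type} [NormedAddCommGroup E] [NormedSpace ℝ E]
    [NormedAddCommGroup F] [NormedSpace ℝ F] (f : E → F) (A : Set E) : Prop :=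
  ∀ x ∈ A, ∃ g : E → F, AnalyticAt ℝ g x ∧ ∀ᶠ y in 𝓝[A] x, f y = g y

/-- `f` restricts to an analytic isomorphism from `A` onto `B`. -/
def IsAnalyticIso {E F : Type} [NormedAddCommGroup E] [NormedSpace ℝ E]
    [NormedAddCommGroup F] [NormedSpace ℝ F] (f : E → F) (A : Set E) (B : Set F) : Prop :=
  Set.BijOn f A B ∧ IsAnalyticOnSubset f A ∧
    ∃ g : F → E, Set.InvOn g f A B ∧ IsAnalyticOnSubset g B

/-- A self-map of `X` is polynomial if it is the restriction of a map which is polynomial in the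
real coordinates. -/
def IsPolynomialMap {V : Type} {X : Set (V → ℂ)} (σ : X → X) : Prop :=
  ∃ q : V × Fin 2 → MvPolynomial (V × Fin 2) ℝ, ∀ (φ : X) (c : V × Fin 2),
    realCoord (σ φ : V → ℂ) c = MvPolynomial.eval (realCoord (φ : V → ℂ)) (q c)

/-- The (polynomial) map `p : φ ↦ φ P` from `X` to `Γ` is an analytically trivial polynomial
covering over `U ⊆ Γ`. -/
structure IsAnalyticallyTrivialPolynomialCovering {V : Type} [Fintype V] (X : Set (V → ℂ)) (P : V)
    (Γ U : Set ℂ) : Prop where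
  mapsTo : ∀ φ ∈ X, φ P ∈ Γ
  /-- The preimage of `U` is the disjoint union of finitely many open sheets, each of which is mapped
  analytically isomorphically onto `U`. -/
  sheets : ∃ (k : ℕ) (S : Fin k → Set (V → ℂ)), 0 < k ∧
    (⋃ i, S i) = {φ ∈ X | φ P ∈ U} ∧
    (∀ i j, i ≠ j → Disjoint (S i) (S j)) ∧
    (∀ i, ∃ N : Set (V → ℂ), IsOpen N ∧ S i = N ∩ {φ ∈ X | φ P ∈ U}) ∧
    ∀ i, IsAnalyticIso (fun φ : V → ℂ => φ P) (S i) U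
  /-- A finite group of polynomial automorphisms of `X` over `Γ` acts simply transitively on the
  fibers over `U`. -/
  deck : ∃ G : Subgroup (Equiv.Perm X), Finite G ∧
    (∀ σ ∈ G, IsPolynomialMap σ ∧ ∀ φ : X, (σ φ : V → ℂ) P = (φ : V → ℂ) P) ∧
    ∀ φ ψ : X, (φ : V → ℂ) P ∈ U → (φ : V → ℂ) P = (ψ : V → ℂ) P → ∃! σ, σ ∈ G ∧ σ φ = ψ

/-! ### Germs of functions constructible by circle intersections -/

/-! Circle intersections suffice to compute polynomials. Consider germs at 0 of functions of `(z,
t)`, where `z` is the input and `t` a scale. Start from `z` and the analytic functions of `t` (fixed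
vertices), and add any `w` that stays at constant distances from two functions already built and is
not collinear with them at 0. The resulting `Traceable` functions are closed under sums, by
parallelograms, and under inversion in a circle, by Peaucellier's rhombus. Products and conjugation
follow from these by algebraic identities. Hence `t ^ d * f (z / t)`, with `d` the degree of `f`, is
traceable (`traceable_homogenized`).

Germs become linkages by rescaling. For small `l`, all points `(l * z, l)` with `|z| < 3 * R` lie
where the germs behave well, and dividing by `l` gives positions over a disk of any prescribed size.
This is a `Design`. Homogeneity keeps the zero set unchanged: the output is `(l ^ d * f z + 1) / l`,
which equals `1 / l` exactly when `f z = 0`.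

Two bars leave a vertex two positions, mirror images of each other. To exclude the wrong one, each
vertex `v` carries two hooks: elbows with arms `3 / 2 * r` attached to the fixed points `mid v ± 2 *
r`. They confine `v` to a lens that contains the disk of radius `r` around `mid v`, lies in that of
radius `3 * r` and avoids both centers. Then the input determines all core vertices
(`IsRealization.core_eq`), and only the elbow signs remain free. Reversing an elbow is the point
reflection in the midpoint of its ends, an affine map, so sign changes form a finite group of scheme
automorphisms.

Fixing the output vertex at `1 / l` restricts the input to the zero set. If `R` bounds `U`, every
elbow over `U` is properly bent, so the sheets are indexed by signs, separated by the strict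
inequalities of `side`, and permuted simply transitively. -/

/-- The determinant of two plane vectors. -/
def cross (x y : ℂ) : ℝ := x.re * y.im - x.im * y.re

/-- The distance between the moving points `u` and `o` is locally constant at `0`. -/
def Rigid (u o : ℂ × ℝ → ℂ) : Prop := ∀ᶠ p in 𝓝 (0 : ℂ × ℝ), ‖u p - o p‖ = ‖u 0 - o 0‖

/-- The moving point `w` is rigidly joined to `a` and `b`, transversally at `0`. -/
structure IsCircle (w a b : ℂ × ℝ → ℂ) : Prop where
  analytic : AnalyticAt ℝ w 0
  left : Rigid w a
  right : Rigid w b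
  cross_ne : cross (w 0 - a 0) (w 0 - b 0) ≠ 0

/-- Functions obtained in at most `n` generations of circle intersections from the first coordinate
and the functions of the second one. -/
def TraceableAt : ℕ → (ℂ × ℝ → ℂ) → Prop
  -- The second coordinate is a scale, constant along any one linkage, so its functions will be the
  -- fixed vertices.
  | 0, w => w = Prod.fst ∨ ∃ k : ℝ → ℂ, AnalyticAt ℝ k 0 ∧ w = fun p => k p.2
  | n + 1, w => TraceableAt n w ∨ ∃ a b, TraceableAt n a ∧ TraceableAt n b ∧ IsCircle w a b

/-- Functions obtained by iterated circle intersections. -/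
def Traceable (w : ℂ × ℝ → ℂ) : Prop := ∃ n, TraceableAt n w

theorem TraceableAt.mono {w : ℂ × ℝ → ℂ} {n m : ℕ} (h : n ≤ m) (hw : TraceableAt n w) : TraceableAt m w := by
  induction h with
  | refl => exact hw
  | step _ ih => exact Or.inl ih

theorem IsCircle.traceable {w a b : ℂ × ℝ → ℂ} (h : IsCircle w a b) (ha : Traceable a) (hb : Traceable b) :
    Traceable w := by
  obtain ⟨n, hn⟩ := ha
  obtain ⟨m, hm⟩ := hb
  exact ⟨max n m + 1, Or.inr ⟨a, b, hn.mono (le_max_left _ _), hm.mono (le_max_right _ _), h⟩⟩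

theorem Traceable.input : Traceable Prod.fst := ⟨0, Or.inl rfl⟩

theorem Traceable.fixed {k : ℝ → ℂ} (hk : AnalyticAt ℝ k 0) : Traceable fun p => k p.2 :=
  ⟨0, Or.inr ⟨k, hk, rfl⟩⟩

theorem Traceable.const (c : ℂ) : Traceable fun _ => c := Traceable.fixed (k := fun _ => c) analyticAt_const

theorem TraceableAt.analyticAt {w : ℂ × ℝ → ℂ} {n : ℕ} (h : TraceableAt n w) : AnalyticAt ℝ w 0 := by
  induction n with
  | zero =>
    rcases h with rfl | ⟨k, hk, rfl⟩
    · exact analyticAt_fst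
    · exact AnalyticAt.fun_comp (g := k) hk analyticAt_snd
  | succ n ih =>
    rcases h with h | ⟨a, b, -, -, h⟩
    · exact ih h
    · exact h.analytic

theorem Traceable.analyticAt {w : ℂ × ℝ → ℂ} (h : Traceable w) : AnalyticAt ℝ w 0 := h.elim fun _ => TraceableAt.analyticAt

theorem IsCircle.congr {w w' a b : ℂ × ℝ → ℂ} (h : IsCircle w a b) (e : w =ᶠ[𝓝 0] w') :
    IsCircle w' a b := by
  have h0 := e.self_of_nhds
  refine ⟨h.analytic.congr e, ?_, ?_, ?_⟩
  · filter_upwards [h.left, e] with p h1 h2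
    rw [← h0, ← h2, h1]
  · filter_upwards [h.right, e] with p h1 h2
    rw [← h0, ← h2, h1]
  · rw [← h0]; exact h.cross_ne

theorem Rigid.symm {u o : ℂ × ℝ → ℂ} (h : Rigid u o) : Rigid o u := by
  filter_upwards [h] with p hp
  rw [norm_sub_rev, hp, norm_sub_rev]

theorem Rigid.of_sub {u o u' o' : ℂ × ℝ → ℂ} (h : Rigid u o) (κ : ℂ)
    (e : ∀ p, u' p - o' p = κ * (u p - o p)) : Rigid u' o' := by
  filter_upwards [h] with p hp
  rw [e, e, norm_mul, norm_mul, hp]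

theorem Rigid.of_sub_one {u o u' o' : ℂ × ℝ → ℂ} (h : Rigid u o)
    (e : ∀ p, u' p - o' p = u p - o p) : Rigid u' o' :=
  h.of_sub 1 fun p => by rw [e, one_mul]

/-! ### Parallelograms, rigid triangles and triangles over a variable base -/

theorem isCircle_parallelogram {o u v : ℂ × ℝ → ℂ} (ho : Traceable o) (hu : Traceable u) (hv : Traceable v)
    (ru : Rigid u o) (rv : Rigid v o) (h : cross (u 0 - o 0) (v 0 - o 0) ≠ 0) :
    IsCircle (fun p => u p + v p - o p) u v where
  analytic := (hu.analyticAt.add hv.analyticAt).sub ho.analyticAt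
  left := rv.of_sub_one fun p => by ring
  right := ru.of_sub_one fun p => by ring
  cross_ne := by
    simp only [cross, Complex.sub_re, Complex.sub_im, Complex.add_re, Complex.add_im] at h ⊢
    contrapose! h
    linarith

theorem Traceable.parallelogram {o u v : ℂ × ℝ → ℂ} (ho : Traceable o) (hu : Traceable u) (hv : Traceable v)
    (ru : Rigid u o) (rv : Rigid v o) (h : cross (u 0 - o 0) (v 0 - o 0) ≠ 0) :
    Traceable fun p => u p + v p - o p :=
  (isCircle_parallelogram ho hu hv ru rv h).traceable hu hv

theorem cross_mul_mul (κ μ x : ℂ) : cross (κ * x) (μ * x) = cross κ μ * Complex.normSq x := by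
  simp only [cross, Complex.mul_re, Complex.mul_im, Complex.normSq_apply]; ring

/-- A rigid triangle of shape `κ` is erected on the bar from `a` to `c`; it is nondegenerate exactly
because `κ` is not real. -/
theorem Traceable.rotate_of_im_ne {a c : ℂ × ℝ → ℂ} (ha : Traceable a) (hc : Traceable c) (r : Rigid c a)
    (h : c 0 ≠ a 0) {κ : ℂ} (hκ : κ.im ≠ 0) : Traceable fun p => a p + κ * (c p - a p) := by
  refine IsCircle.traceable (a := a) (b := c) ⟨?_, ?_, ?_, ?_⟩ ha hc
  · exact ha.analyticAt.add (analyticAt_const.mul (hc.analyticAt.sub ha.analyticAt))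
  · exact r.of_sub κ fun p => by ring
  · exact r.of_sub (κ - 1) fun p => by ring
  · have e1 : a 0 + κ * (c 0 - a 0) - a 0 = κ * (c 0 - a 0) := by ring
    have e2 : a 0 + κ * (c 0 - a 0) - c 0 = (κ - 1) * (c 0 - a 0) := by ring
    rw [e1, e2, cross_mul_mul]
    refine mul_ne_zero ?_ (by simpa [sub_eq_zero] using h)
    simp only [cross, Complex.sub_re, Complex.sub_im, Complex.one_re, Complex.one_im]
    contrapose! hκ
    linarith

/-- For real `κ` the triangle would be flat, violating transversality. Two right triangles are used
instead, with factors `I` and `-I * κ`. -/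
theorem Traceable.rotate {a c : ℂ × ℝ → ℂ} (ha : Traceable a) (hc : Traceable c) (r : Rigid c a)
    (h : c 0 ≠ a 0) (κ : ℂ) : Traceable fun p => a p + κ * (c p - a p) := by
  by_cases hκ : κ.im ≠ 0
  · exact ha.rotate_of_im_ne hc r h hκ
  by_cases h0 : κ = 0
  · simpa [h0] using ha
  have hre : κ.re ≠ 0 := fun h' => h0 (Complex.ext h' (not_not.1 hκ))
  have h1 := ha.rotate_of_im_ne hc r h (κ := Complex.I) (by simp)
  have h2 := ha.rotate_of_im_ne h1 (r.of_sub Complex.I fun p => by ring)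
    (by simpa [sub_eq_zero] using h) (κ := -Complex.I * κ) (by simpa using hre)
  convert h2 using 2 with p
  linear_combination (κ * (c p - a p)) * Complex.I_sq

/-- The coefficients `α + i β` of the apex of a triangle with base of variable length `√d` and two
sides of constant lengths. -/
theorem exists_apex_coeff {d : ℂ × ℝ → ℝ} (hd : AnalyticAt ℝ d 0) (h0 : 0 < d 0) {κ : ℂ}
    (hκ : κ.im ≠ 0) : ∃ α β : ℂ × ℝ → ℝ, AnalyticAt ℝ α 0 ∧ AnalyticAt ℝ β 0 ∧ α 0 = κ.re ∧
      β 0 = κ.im ∧ (∀ p, α p = (1 + (2 * κ.re - 1) * d 0 / d p) / 2) ∧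
      ∀ᶠ p in 𝓝 0, (α p ^ 2 + β p ^ 2) * d p = (κ.re ^ 2 + κ.im ^ 2) * d 0 ∧
        ((α p - 1) ^ 2 + β p ^ 2) * d p = ((κ.re - 1) ^ 2 + κ.im ^ 2) * d 0 := by
  -- Subtracting the two length equations gives `(2 * α - 1) * d = (2 * κ.re - 1) * d 0`, which
  -- determines `α`; either equation then determines `β ^ 2`.
  have hα : AnalyticAt ℝ (fun p => (1 + (2 * κ.re - 1) * d 0 / d p) / 2) 0 :=
    (analyticAt_const.add (analyticAt_const.div hd h0.ne')).div analyticAt_const two_ne_zero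
  set α : ℂ × ℝ → ℝ := fun p => (1 + (2 * κ.re - 1) * d 0 / d p) / 2 with hαdef
  have hα0 : α 0 = κ.re := by simp only [hαdef]; field_simp; ring
  have hγ : AnalyticAt ℝ (fun p => (κ.re ^ 2 + κ.im ^ 2) * d 0 / d p - α p ^ 2) 0 :=
    (analyticAt_const.div hd h0.ne').sub (hα.pow 2)
  have hγ0 : (κ.re ^ 2 + κ.im ^ 2) * d 0 / d 0 - α 0 ^ 2 = κ.im ^ 2 := by
    rw [hα0]; field_simp; ring
  have hpos : 0 < κ.im ^ 2 := by positivity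
  -- The sign selects the square root with the prescribed value `κ.im` at 0.
  set s : ℝ := ((SignType.sign κ.im : SignType) : ℝ) with hs
  have hs2 : s ^ 2 = 1 := by
    rcases lt_or_gt_of_ne hκ with h | h <;> simp [hs, h]
  refine ⟨α, fun p => s * √((κ.re ^ 2 + κ.im ^ 2) * d 0 / d p - α p ^ 2), hα, ?_, hα0, ?_,
    fun p => rfl, ?_⟩
  · refine analyticAt_const.mul ?_
    exact AnalyticAt.fun_comp (g := Real.sqrt) (by
      rw [hγ0]; exact (Real.contDiffAt_sqrt (n := ⊤) hpos.ne').analyticAt) hγ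
  · show s * √((κ.re ^ 2 + κ.im ^ 2) * d 0 / d 0 - α 0 ^ 2) = κ.im
    rw [hγ0, Real.sqrt_sq_eq_abs, hs, mul_comm, abs_mul_sign]
  · have c1 : ∀ᶠ p in 𝓝 0, 0 < d p := hd.continuousAt.eventually_const_lt h0
    have c2 : ∀ᶠ p in 𝓝 0, 0 < (κ.re ^ 2 + κ.im ^ 2) * d 0 / d p - α p ^ 2 :=
      hγ.continuousAt.eventually_const_lt (hpos.trans_eq hγ0.symm)
    filter_upwards [c1, c2] with p h1 h2
    rw [mul_pow, hs2, one_mul, Real.sq_sqrt h2.le]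
    have e : α p * d p = (d p + (2 * κ.re - 1) * d 0) / 2 := by
      simp only [hαdef]; field_simp
    constructor
    · field_simp; ring
    · have : ((κ.re ^ 2 + κ.im ^ 2) * d 0 / d p) * d p = (κ.re ^ 2 + κ.im ^ 2) * d 0 := by
        field_simp
      linear_combination this - 2 * e

theorem norm_mul_re_im (x : ℂ) (α β : ℝ) :
    ‖x * (α + β * Complex.I)‖ ^ 2 = (α ^ 2 + β ^ 2) * Complex.normSq x := by
  rw [Complex.sq_norm, Complex.normSq_mul, Complex.normSq_apply (α + β * Complex.I)]
  simp; ring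

theorem AnalyticAt.complex_ofReal {E : Type*} [NormedAddCommGroup E] [NormedSpace ℝ E] {α : E → ℝ}
    {p : E} (h : AnalyticAt ℝ α p) : AnalyticAt ℝ (fun q => (α q : ℂ)) p :=
  AnalyticAt.fun_comp (g := fun x : ℝ => (x : ℂ)) (Complex.ofRealCLM.analyticAt _) h

theorem AnalyticAt.complex_re {E : Type*} [NormedAddCommGroup E] [NormedSpace ℝ E] {w : E → ℂ}
    {p : E} (h : AnalyticAt ℝ w p) : AnalyticAt ℝ (fun q => (w q).re) p :=
  AnalyticAt.fun_comp (g := fun x : ℂ => x.re) (Complex.reCLM.analyticAt _) h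

theorem AnalyticAt.complex_im {E : Type*} [NormedAddCommGroup E] [NormedSpace ℝ E] {w : E → ℂ}
    {p : E} (h : AnalyticAt ℝ w p) : AnalyticAt ℝ (fun q => (w q).im) p :=
  AnalyticAt.fun_comp (g := fun x : ℂ => x.im) (Complex.imCLM.analyticAt _) h

/-- The two apices over the variable base `[o z]`, symmetric with respect to it. -/
theorem Traceable.exists_apices {o z : ℂ × ℝ → ℂ} (ho : Traceable o) (hz : Traceable z)
    (h : z 0 ≠ o 0) {κ : ℂ} (hκ : κ.im ≠ 0) : ∃ A B : ℂ × ℝ → ℂ, IsCircle A o z ∧ IsCircle B o z ∧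
      A 0 = o 0 + κ * (z 0 - o 0) ∧ B 0 = o 0 + (starRingEnd ℂ) κ * (z 0 - o 0) ∧
      ∀ p, A p + B p - z p = o p + (2 * κ.re - 1 : ℝ) * Complex.normSq (z 0 - o 0) *
        ((z p - o p) / Complex.normSq (z p - o p)) := by
  have hzo := hz.analyticAt.sub ho.analyticAt
  have hd : AnalyticAt ℝ (fun p => Complex.normSq (z p - o p)) 0 := by
    simp only [Complex.normSq_apply]
    exact (hzo.complex_re.mul hzo.complex_re).add (hzo.complex_im.mul hzo.complex_im)
  have h0 : 0 < Complex.normSq (z 0 - o 0) := Complex.normSq_pos.2 (sub_ne_zero.2 h)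
  obtain ⟨α, β, hα, hβ, hα0, hβ0, hαp, hev⟩ := exists_apex_coeff hd h0 hκ
  have key : ∀ (β' : ℂ × ℝ → ℝ), AnalyticAt ℝ β' 0 → (β' 0 ≠ 0) → (∀ p, β' p ^ 2 = β p ^ 2) →
      IsCircle (fun p => o p + (z p - o p) * (α p + β' p * Complex.I)) o z := by
    intro β' hβ' hne hsq
    refine ⟨?_, ?_, ?_, ?_⟩
    · exact ho.analyticAt.add (hzo.mul (hα.complex_ofReal.add
        (hβ'.complex_ofReal.mul analyticAt_const)))
    · filter_upwards [hev] with p hp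
      have e : ∀ p, o p + (z p - o p) * (α p + β' p * Complex.I) - o p =
        (z p - o p) * (α p + β' p * Complex.I) := fun p => by ring
      rw [e, e, ← sq_eq_sq₀ (norm_nonneg _) (norm_nonneg _), norm_mul_re_im, norm_mul_re_im, hsq,
        hsq, hp.1, hα0, hβ0]
    · filter_upwards [hev] with p hp
      have e : ∀ p, o p + (z p - o p) * (α p + β' p * Complex.I) - z p =
        (z p - o p) * ((α p - 1 : ℝ) + β' p * Complex.I) := fun p => by push_cast; ring
      rw [e, e, ← sq_eq_sq₀ (norm_nonneg _) (norm_nonneg _), norm_mul_re_im, norm_mul_re_im, hsq,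
        hsq, hp.2, hα0, hβ0]
    · have e1 : o 0 + (z 0 - o 0) * (α 0 + β' 0 * Complex.I) - o 0 =
        (α 0 + β' 0 * Complex.I) * (z 0 - o 0) := by ring
      have e2 : o 0 + (z 0 - o 0) * (α 0 + β' 0 * Complex.I) - z 0 =
        ((α 0 - 1 : ℝ) + β' 0 * Complex.I) * (z 0 - o 0) := by push_cast; ring
      rw [e1, e2, cross_mul_mul]
      refine mul_ne_zero ?_ h0.ne'
      simp only [cross]
      contrapose! hne
      simp at hne
      linarith
  refine ⟨_, _, key β hβ (by rwa [hβ0]) fun _ => rfl,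
    key (fun p => -β p) hβ.neg (by simpa [hβ0] using hκ) fun _ => neg_sq _, ?_, ?_, ?_⟩
  · simp only [hα0, hβ0]; rw [Complex.re_add_im]; ring
  · simp only [hα0, hβ0]
    congr 1
    rw [mul_comm]
    congr 1
    apply Complex.ext <;> simp
  -- The components orthogonal to the base cancel, leaving `2 * α - 1` times `z - o`: a multiple of
  -- the inversion centered at `o`.
  · intro p
    have e := hαp p
    have : (α p : ℂ) = (1 + (2 * κ.re - 1) * Complex.normSq (z 0 - o 0) /
      Complex.normSq (z p - o p)) / 2 := by rw [e]; push_cast; rfl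
    simp only [this]; push_cast; ring

/-! ### Addition and multiplication by constants -/

theorem eventually_add_mul_ne_zero {a b : ℝ} (h : a ≠ 0 ∨ b ≠ 0) :
    ∀ᶠ τ in 𝓝[≠] (0 : ℝ), a + τ * b ≠ 0 := by
  by_cases ha : a = 0
  · filter_upwards [self_mem_nhdsWithin] with τ hτ
    have hb : b ≠ 0 := by tauto
    simpa [ha] using ⟨hτ, hb⟩
  · have : ContinuousAt (fun τ : ℝ => a + τ * b) 0 := by fun_prop
    exact (this.eventually_ne (by simpa using ha)).filter_mono nhdsWithin_le_nhds

/-- The determinant is affine in `τ`, with coefficients half the cross product and the scalar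
product of `x` and `y`. Both cannot vanish, since the sum of their squares is `|x|² |y|²`. -/
theorem eventually_cross_ne_zero {x y : ℂ} (hx : x ≠ 0) (hy : y ≠ 0) :
    ∀ᶠ τ : ℝ in 𝓝[≠] 0, cross x ((1 / 2 + τ * Complex.I) * y) ≠ 0 := by
  have h : cross x y / 2 ≠ 0 ∨ cross x (Complex.I * y) ≠ 0 := by
    by_contra! h
    simp only [cross, Complex.mul_re, Complex.mul_im, Complex.I_re, Complex.I_im] at h
    have h1 : (x.re ^ 2 + x.im ^ 2) * (y.re ^ 2 + y.im ^ 2) = 0 := by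
      linear_combination (2 * (x.re * y.im - x.im * y.re)) * h.1 +
        (x.re * y.re + x.im * y.im) * h.2
    have h2 : Complex.normSq x * Complex.normSq y = 0 := by
      rw [Complex.normSq_apply, Complex.normSq_apply]; linarith
    simp [hx, hy] at h2
  filter_upwards [eventually_add_mul_ne_zero h] with τ hτ
  convert hτ using 1
  simp [cross]
  ring

/-- The sum of the vectors `z - o` and `w - o`, put at `o`, by four parallelograms. -/
theorem Traceable.exists_isCircle_add_sub {z w : ℂ × ℝ → ℂ} (hz : Traceable z) (hw : Traceable w)
    (o : ℂ) (hzo : z 0 ≠ o) (hwo : w 0 ≠ o) :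
    ∃ a b, Traceable a ∧ Traceable b ∧ IsCircle (fun p => z p + w p - o) a b := by
  have ho := Traceable.const o
  obtain ⟨A, -, hA, -, hA0, -, -⟩ := ho.exists_apices hz hzo (κ := 1 / 2 + Complex.I) (by simp)
  have hzo' := sub_ne_zero.2 hzo
  have hwo' := sub_ne_zero.2 hwo
  have hu : A 0 - o ≠ 0 := by
    rw [hA0, add_sub_cancel_left]
    refine mul_ne_zero (fun h => ?_) hzo'
    simpa using congrArg Complex.im h
  have hv : z 0 - A 0 ≠ 0 := by
    rw [hA0, show z 0 - (o + (1 / 2 + Complex.I) * (z 0 - o)) =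
      (1 / 2 - Complex.I) * (z 0 - o) by ring]
    refine mul_ne_zero (fun h => ?_) hzo'
    simpa using congrArg Complex.im h
  have tendsto_neg : Tendsto (fun τ : ℝ => -τ) (𝓝[≠] 0) (𝓝[≠] 0) := by
    refine tendsto_nhdsWithin_iff.2 ⟨?_, ?_⟩
    · exact ((continuous_neg.tendsto' (0 : ℝ) 0 neg_zero)).mono_left nhdsWithin_le_nhds
    · filter_upwards [self_mem_nhdsWithin] with τ hτ
      simpa using hτ
  -- Each vector is split into two of constant length, `z - o = (A - o) + (z - A)` and `w - o = (B -
  -- o) + (w - B)`. Each piece of the first must be transversal at 0 to each piece of the second; a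
  -- generic height `τ` of `B` achieves this, `-τ` being the parameter of `w - B`.
  obtain ⟨τ, hτ, h1, h2, h3, h4⟩ := ((eventually_mem_nhdsWithin).and
    ((eventually_cross_ne_zero hu hwo').and ((eventually_cross_ne_zero hv hwo').and
    ((tendsto_neg.eventually (eventually_cross_ne_zero hu hwo')).and
    (tendsto_neg.eventually (eventually_cross_ne_zero hv hwo')))))).exists
  obtain ⟨B, -, hB, -, hB0, -, -⟩ := ho.exists_apices hw hwo (κ := 1 / 2 + τ * Complex.I)
    (by simpa using hτ)
  have eu : B 0 - o = (1 / 2 + τ * Complex.I) * (w 0 - o) := by rw [hB0]; ring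
  have ev : w 0 - B 0 = (1 / 2 + ((-τ : ℝ) : ℂ) * Complex.I) * (w 0 - o) := by
    rw [hB0]; push_cast; ring
  rw [← eu] at h1 h2
  rw [← ev] at h3 h4
  have cA := hA.traceable ho hz
  have cB := hB.traceable ho hw
  have cAB := ho.parallelogram cA cB hA.left hB.left h1
  have czB := cA.parallelogram hz cAB hA.right.symm (hB.left.of_sub_one fun p => by ring)
    (by convert h2 using 2; ring)
  have cAw := cB.parallelogram cAB hw (hA.left.of_sub_one fun p => by ring) hB.right.symm
    (by convert h3 using 2; ring)
  refine ⟨_, _, czB, cAw, ?_⟩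
  refine (isCircle_parallelogram cAB czB cAw (hA.right.symm.of_sub_one fun p => by ring)
    (hB.right.symm.of_sub_one fun p => by ring) (by convert h4 using 2 <;> ring)).congr
    (.of_eq (funext fun p => by ring))

/-- The sum is first formed relative to an auxiliary origin `o`; a second sum, relative to `o'`,
translates it back. The choice `o ≠ 0` makes that translation nonzero. -/
theorem Traceable.add {z w : ℂ × ℝ → ℂ} (hz : Traceable z) (hw : Traceable w) :
    Traceable fun p => z p + w p := by
  obtain ⟨o, ho⟩ := Set.Infinite.exists_notMem_finset (s := (Set.univ : Set ℂ))
    Set.infinite_univ {0, z 0, w 0}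
  simp only [Finset.mem_insert, Finset.mem_singleton, not_or] at ho
  obtain ⟨-, ho0, hoz, how⟩ := ho
  obtain ⟨a, b, ha, hb, h⟩ := hz.exists_isCircle_add_sub hw o (Ne.symm hoz) (Ne.symm how)
  have h1 := h.traceable ha hb
  obtain ⟨o', ho'⟩ := Set.Infinite.exists_notMem_finset (s := (Set.univ : Set ℂ))
    Set.infinite_univ {z 0 + w 0 - o}
  obtain ⟨a, b, ha, hb, h⟩ := h1.exists_isCircle_add_sub (Traceable.const (o' + o)) o'
    (by simpa [eq_comm] using ho'.2) (by simpa using ho0)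
  exact (h.congr (.of_eq (funext fun p => by ring))).traceable ha hb

/-- Beyond traceability, this presents the translate as a circle intersection, hence as a vertex
which need not be fixed even if `z` is. -/
theorem Traceable.exists_isCircle_add_const {z : ℂ × ℝ → ℂ} (hz : Traceable z) {c : ℂ}
    (hc : c ≠ 0) : ∃ a b, Traceable a ∧ Traceable b ∧ IsCircle (fun p => z p + c) a b := by
  obtain ⟨o, ho⟩ := exists_ne (z 0)
  obtain ⟨a, b, ha, hb, h⟩ := hz.exists_isCircle_add_sub (Traceable.const (o + c)) o ho.symm
    (by simpa using hc)
  exact ⟨a, b, ha, hb, h.congr (.of_eq (funext fun p => by ring))⟩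

/-- Generation zero of `TraceableAt` requires equality of functions, but a circle intersection only
depends on germs. Translating by 1 and back makes the last operation a circle intersection. -/
theorem Traceable.congr {z w : ℂ × ℝ → ℂ} (hz : Traceable z) (e : z =ᶠ[𝓝 0] w) : Traceable w := by
  obtain ⟨a, b, ha, hb, h⟩ := (hz.add (.const 1)).exists_isCircle_add_const (c := -1) (by simp)
  refine (h.congr ?_).traceable ha hb
  filter_upwards [e] with p hp
  rw [← hp]; ring

/-- The vector `z - o` has variable length and is not a bar. It is split at an apex `A` into two
vectors of constant length; both are attached to `o`, multiplied by `κ` by means of rigid triangles,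
and added in a parallelogram. -/
theorem Traceable.const_mul {z : ℂ × ℝ → ℂ} (hz : Traceable z) (κ : ℂ) :
    Traceable fun p => κ * z p := by
  by_cases hκ : κ = 0
  · simpa [hκ] using Traceable.const 0
  obtain ⟨o, hoz⟩ := exists_ne (z 0)
  have ho := Traceable.const o
  have hzo := sub_ne_zero.2 hoz.symm
  obtain ⟨A, -, hA, -, hA0, -, -⟩ := ho.exists_apices hz hoz.symm (κ := 1 / 2 + Complex.I) (by simp)
  have cA := hA.traceable ho hz
  have e1 : A 0 - o = (1 / 2 + Complex.I) * (z 0 - o) := by rw [hA0]; ring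
  have e2 : z 0 - A 0 = (1 / 2 - Complex.I) * (z 0 - o) := by rw [hA0]; ring
  have hcross : ∀ κ, κ ≠ 0 → cross (κ * (A 0 - o)) (κ * (z 0 - A 0)) ≠ 0 := by
    intro κ hκ
    rw [e1, e2, ← mul_assoc, ← mul_assoc, cross_mul_mul]
    refine mul_ne_zero ?_ (by simpa using hzo)
    rw [mul_comm κ, mul_comm κ, cross_mul_mul]
    refine mul_ne_zero ?_ (by simpa using hκ)
    norm_num [cross]
  have cV := cA.parallelogram hz ho hA.right.symm hA.left.symm (by
    have := hcross 1 one_ne_zero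
    simp only [cross, one_mul, Complex.sub_re, Complex.sub_im] at this ⊢
    contrapose! this
    linarith)
  have rV : Rigid (fun p => z p + o - A p) fun _ => o := hA.right.symm.of_sub_one fun p => by ring
  have c1 := ho.rotate cA hA.left (fun h => by
    refine hcross 1 one_ne_zero ?_
    simp [h, cross]) κ
  have c2 := ho.rotate cV rV (fun h => by
    refine hcross 1 one_ne_zero ?_
    have : z 0 - A 0 = 0 := by linear_combination h
    simp [this, cross]) κ
  have c3 := ho.parallelogram c1 c2 (hA.left.of_sub κ fun p => by ring)
    (hA.right.symm.of_sub κ fun p => by ring) (by convert hcross κ hκ using 2 <;> ring)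
  convert c3.add (.const (κ * o - o)) using 2 with p
  ring

theorem Traceable.neg {z : ℂ × ℝ → ℂ} (hz : Traceable z) : Traceable fun p => -z p := by
  simpa using hz.const_mul (-1)

theorem Traceable.sub {z w : ℂ × ℝ → ℂ} (hz : Traceable z) (hw : Traceable w) :
    Traceable fun p => z p - w p := by
  simpa [sub_eq_add_neg] using hz.add hw.neg

/-! ### Inversion, products and conjugation -/

/-- Inversion in the unit circle, by the linkage of Peaucellier. -/
theorem Traceable.inv_conj {z : ℂ × ℝ → ℂ} (hz : Traceable z) (h0 : z 0 ≠ 0) :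
    Traceable fun p => ((starRingEnd ℂ) (z p))⁻¹ := by
  have ho := Traceable.const 0
  obtain ⟨A, B, hA, hB, hA0, hB0, h⟩ := ho.exists_apices hz h0 (κ := 2 + Complex.I) (by simp)
  have cA := hA.traceable ho hz
  have cB := hB.traceable ho hz
  have c := hz.parallelogram cA cB hA.right hB.right (by
    rw [hA0, hB0, show 0 + (2 + Complex.I) * (z 0 - 0) - z 0 = (1 + Complex.I) * z 0 by ring,
      show 0 + (starRingEnd ℂ) (2 + Complex.I) * (z 0 - 0) - z 0 = (1 - Complex.I) * z 0 by
        rw [map_add, Complex.conj_I, Complex.conj_ofNat]; ring, cross_mul_mul]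
    refine mul_ne_zero ?_ (by simpa using h0)
    norm_num [cross])
  have hne : (Complex.normSq (z 0) : ℂ) ≠ 0 := by
    simpa using h0
  -- For `κ = 2 + I` the factor `2 * κ.re - 1` is 3, so the rhombus gives `3 * |z 0|² / conj z`.
  convert c.const_mul (3 * Complex.normSq (z 0))⁻¹ using 2 with p
  rw [h]
  by_cases hp : z p = 0
  · simp [hp]
  have hp' : (starRingEnd ℂ) (z p) ≠ 0 := by simpa using hp
  simp only [sub_zero, Complex.add_re, Complex.re_ofNat, Complex.I_re]
  rw [Complex.normSq_eq_conj_mul_self (z := z p)]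
  push_cast
  field_simp
  ring

/-- Conjugating `1 / conj (z - c) - 1 / conj (z + c)` gives `2 * c / (z ^ 2 - c ^ 2)`; one more
inversion puts the square in the numerator. The constant `c` keeps the inverted quantities away from
0. -/
theorem Traceable.sq {z : ℂ × ℝ → ℂ} (hz : Traceable z) : Traceable fun p => z p ^ 2 := by
  obtain ⟨c, hc⟩ := Set.Infinite.exists_notMem_finset (s := (Set.univ : Set ℂ))
    Set.infinite_univ {0, z 0, -z 0}
  simp only [Finset.mem_insert, Finset.mem_singleton, not_or] at hc
  obtain ⟨-, hc0, h1, h2⟩ := hc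
  have n1 : z 0 - c ≠ 0 := fun h => h1 (by linear_combination -h)
  have n2 : z 0 + c ≠ 0 := fun h => h2 (by linear_combination h)
  have hm := hz.sub (.const c)
  have hp := hz.add (.const c)
  have hd := (hm.inv_conj n1).sub (hp.inv_conj n2)
  have eq : ∀ a b : ℂ, a - c ≠ 0 → a + c ≠ 0 → b = ((starRingEnd ℂ) (a - c))⁻¹ -
      ((starRingEnd ℂ) (a + c))⁻¹ → b ≠ 0 ∧ (2 * c) * ((starRingEnd ℂ) b)⁻¹ + c ^ 2 = a ^ 2 := by
    rintro a b h1 h2 rfl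
    have h3 : (starRingEnd ℂ) (((starRingEnd ℂ) (a - c))⁻¹ - ((starRingEnd ℂ) (a + c))⁻¹) =
        2 * c / ((a - c) * (a + c)) := by
      simp only [map_sub, map_inv₀, Complex.conj_conj, map_add]
      field_simp
      ring
    have h4 : 2 * c / ((a - c) * (a + c)) ≠ 0 :=
      div_ne_zero (mul_ne_zero two_ne_zero hc0) (mul_ne_zero h1 h2)
    refine ⟨fun h => h4 (by rw [← h3, h, map_zero]), ?_⟩
    rw [h3]
    field_simp
    ring
  have hs := ((hd.inv_conj (eq _ _ n1 n2 rfl).1).const_mul (2 * c)).add (.const (c ^ 2))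
  refine hs.congr ?_
  filter_upwards [hm.analyticAt.continuousAt.eventually_ne n1,
    hp.analyticAt.continuousAt.eventually_ne n2] with p h1 h2
  exact (eq _ _ h1 h2 rfl).2

theorem Traceable.mul {z w : ℂ × ℝ → ℂ} (hz : Traceable z) (hw : Traceable w) :
    Traceable fun p => z p * w p := by
  convert ((hz.add hw).sq.sub (hz.sub hw).sq).const_mul (1 / 4) using 2 with p
  ring

/-- With `b = 1 + a / conj a`, the conjugate inverse of `b` is `s = a / (a + conj a)`, and that of
`1 - s` is `1 + conj a / a`; multiply by `a` and subtract `a`. The denominators are powers of `a`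
and twice its real part, whence the hypothesis, which `Traceable.conj` removes by a real
translation. -/
theorem Traceable.conj_of_re_ne {z : ℂ × ℝ → ℂ} (hz : Traceable z) (h0 : (z 0).re ≠ 0) :
    Traceable fun p => (starRingEnd ℂ) (z p) := by
  have key : ∀ a : ℂ, a.re ≠ 0 → ∀ b s, b = 1 + a * ((starRingEnd ℂ) a)⁻¹ →
      s = ((starRingEnd ℂ) b)⁻¹ → b ≠ 0 ∧ 1 - s ≠ 0 ∧
      a * ((starRingEnd ℂ) (1 - s))⁻¹ - a = (starRingEnd ℂ) a := by
    rintro a ha b s rfl rfl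
    have ha0 : a ≠ 0 := fun h => ha (by simp [h])
    have ha1 : (starRingEnd ℂ) a ≠ 0 := by simpa using ha0
    have hx : a + (starRingEnd ℂ) a ≠ 0 := by
      rw [Complex.add_conj]; simpa using ha
    have hx' : (starRingEnd ℂ) a + a ≠ 0 := by rwa [add_comm]
    have e1 : 1 + a * ((starRingEnd ℂ) a)⁻¹ = ((starRingEnd ℂ) a + a) / (starRingEnd ℂ) a := by
      field_simp
    have e2 : 1 - ((starRingEnd ℂ) (1 + a * ((starRingEnd ℂ) a)⁻¹))⁻¹ =
        (starRingEnd ℂ) a / ((starRingEnd ℂ) a + a) := by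
      rw [e1, map_div₀, map_add, Complex.conj_conj]; field_simp; ring
    refine ⟨?_, ?_, ?_⟩
    · rw [e1]; exact div_ne_zero hx' ha1
    · rw [e2]; exact div_ne_zero ha1 hx'
    · rw [e2, map_div₀, map_add, Complex.conj_conj]; field_simp; ring
  have hne : z 0 ≠ 0 := fun h => h0 (by simp [h])
  have hb := (Traceable.const 1).add (hz.mul (hz.inv_conj hne))
  have k0 := key _ h0 _ _ rfl rfl
  have hs := (Traceable.const 1).sub (hb.inv_conj k0.1)
  refine ((hz.mul (hs.inv_conj k0.2.1)).sub hz).congr ?_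
  filter_upwards [hz.analyticAt.complex_re.continuousAt.eventually_ne h0] with p hp
  exact (key _ hp _ _ rfl rfl).2.2

theorem Traceable.conj {z : ℂ × ℝ → ℂ} (hz : Traceable z) :
    Traceable fun p => (starRingEnd ℂ) (z p) := by
  obtain ⟨c, hc⟩ := exists_ne (-(z 0).re)
  have h := (hz.add (.const (c : ℂ))).conj_of_re_ne (by
    rw [Complex.add_re, Complex.ofReal_re]
    exact fun h => hc (by linarith))
  convert h.sub (.const (c : ℂ)) using 2 with p
  simp

theorem Traceable.pow {z : ℂ × ℝ → ℂ} (hz : Traceable z) (n : ℕ) : Traceable fun p => z p ^ n := by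
  induction n with
  | zero => simpa using Traceable.const 1
  | succ n ih => simpa [pow_succ] using ih.mul hz

theorem Traceable.sum {ι : Type*} (s : Finset ι) (z : ι → ℂ × ℝ → ℂ) (h : ∀ i ∈ s, Traceable (z i)) :
    Traceable fun p => ∑ i ∈ s, z i p := by
  classical
  induction s using Finset.induction_on with
  | empty => simpa using Traceable.const 0
  | insert a s ha ih =>
    simp only [Finset.sum_insert ha]
    exact (h a (by simp)).add (ih fun i hi => h i (by simp [hi]))

/-! ### Homogenized polynomials -/

/-- The homogenization of the real polynomial map `z ↦ f (z, z̄)`. -/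
noncomputable def homogenized (f : MvPolynomial (Fin 2) ℂ) (p : ℂ × ℝ) : ℂ :=
  ∑ m ∈ f.support, (f.coeff m * (p.2 : ℂ) ^ (f.totalDegree - (m 0 + m 1))) *
    (p.1 ^ m 0 * (starRingEnd ℂ) p.1 ^ m 1)

theorem traceable_homogenized (f : MvPolynomial (Fin 2) ℂ) : Traceable (homogenized f) := by
  refine Traceable.sum _ _ fun m _ => ?_
  refine Traceable.mul ?_ ((Traceable.input.pow _).mul (Traceable.input.conj.pow _))
  exact Traceable.fixed (k := fun t : ℝ => f.coeff m * (t : ℂ) ^ (f.totalDegree - (m 0 + m 1)))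
    (analyticAt_const.mul (AnalyticAt.pow (Complex.ofRealCLM.analyticAt _) _))

theorem homogenized_mul (f : MvPolynomial (Fin 2) ℂ) (z : ℂ) (t : ℝ) :
    homogenized f (t * z, t) =
      (t : ℂ) ^ f.totalDegree * MvPolynomial.eval ![z, (starRingEnd ℂ) z] f := by
  rw [MvPolynomial.eval_eq', Finset.mul_sum]
  refine Finset.sum_congr rfl fun m hm => ?_
  have hle : m 0 + m 1 ≤ f.totalDegree := by
    have := MvPolynomial.le_totalDegree hm
    rwa [Finsupp.sum_fintype _ _ (fun _ => rfl), Fin.sum_univ_two] at this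
  obtain ⟨k, hk⟩ := Nat.exists_eq_add_of_le hle
  rw [hk, Nat.add_sub_cancel_left, Fin.prod_univ_two]
  simp only [map_mul, Complex.conj_ofReal, Matrix.cons_val_zero, Matrix.cons_val_one]
  ring

/-! ### The configuration ideal -/

namespace MarkedLinkage

variable {V : Type} {s : ℕ} {L : MarkedLinkage V s} {Z : Fin s → ℂ}

theorem eval_edgeEq (φ : V → ℂ) (v w : V) : MvPolynomial.eval (realCoord φ) (L.edgeEq v w) =
    ‖φ v - φ w‖ ^ 2 - L.len s(v, w) ^ 2 := by
  rw [Complex.sq_norm, Complex.normSq_apply]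
  simp [edgeEq, realCoord]
  ring

theorem edgeEq_mem {v w : V} (h : L.graph.Adj v w) : L.edgeEq v w ∈ L.ideal Z :=
  Ideal.subset_span (Or.inl (Or.inl ⟨v, w, h, rfl⟩))

theorem markEq_mem (j : Fin s) (i : Fin 2) : L.markEq Z j i ∈ L.ideal Z :=
  Ideal.subset_span (Or.inl (Or.inr ⟨j, i, rfl⟩))

theorem barEq_mem {a b c : V} (h : L.IsDegenerateTriangle a b c) (i : Fin 2) :
    L.barEq a b c i ∈ L.ideal Z :=
  Ideal.subset_span (Or.inr ⟨a, b, c, i, h, rfl⟩)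

theorem norm_sub_eq {φ : V → ℂ} (hφ : φ ∈ L.config Z) {v w : V} (h : L.graph.Adj v w) :
    ‖φ v - φ w‖ = L.len s(v, w) :=
  (sq_eq_sq₀ (norm_nonneg _) (L.len_pos s(v, w) h).le).1 (hφ.1 v w h)

/-- Equality in the triangle inequality puts the two short sides on the same ray, so on real points
the bar equations follow from the edge equations. -/
theorem bar_of_mem_config {φ : V → ℂ} (hφ : φ ∈ L.config Z) {a b c : V}
    (h : L.IsDegenerateTriangle a b c) :
    L.len s(a, c) * φ b = L.len s(b, c) * φ a + L.len s(a, b) * φ c := by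
  obtain ⟨hab, hbc, hac, hl⟩ := h
  have h1 := norm_sub_eq hφ hab
  have h2 := norm_sub_eq hφ hbc
  have h3 := norm_sub_eq hφ hac
  have p1 := L.len_pos s(a, b) hab
  have p2 := L.len_pos s(b, c) hbc
  have hs : SameRay ℝ (φ a - φ b) (φ b - φ c) := by
    rw [sameRay_iff_norm_add, h1, h2, ← hl, ← h3]
    congr 1; ring
  have h4 := hs.norm_smul_eq
  rw [h1, h2, Complex.real_smul, Complex.real_smul] at h4
  rw [hl]; push_cast
  linear_combination h4

theorem eval_eq_zero {φ : V → ℂ} (hφ : φ ∈ L.config Z) {q : MvPolynomial (V × Fin 2) ℝ}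
    (hq : q ∈ L.ideal Z) : MvPolynomial.eval (realCoord φ) q = 0 := by
  have : L.ideal Z ≤ RingHom.ker (MvPolynomial.eval (realCoord φ)) := by
    refine Ideal.span_le.2 ?_
    rintro q ((⟨v, w, h, rfl⟩ | ⟨j, i, rfl⟩) | ⟨a, b, c, i, h, rfl⟩)
    · simp only [SetLike.mem_coe, RingHom.mem_ker, eval_edgeEq, hφ.1 v w h, sub_self]
    · have := hφ.2 j
      fin_cases i <;> simp [markEq, realCoord, this]
    · have := bar_of_mem_config hφ h
      have hre := congrArg Complex.re this
      have him := congrArg Complex.im this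
      simp at hre him
      fin_cases i <;> simp [barEq, realCoord, hre, him]
  exact this hq

/-! ### Germs of functions in the analytic ideal -/

section

variable [Fintype V] {φ : V → ℂ}

theorem InAnalyticIdeal.congr {u u' : (V → ℂ) → ℝ} (h : L.InAnalyticIdeal Z φ u)
    (e : u =ᶠ[𝓝 φ] u') : L.InAnalyticIdeal Z φ u' := by
  obtain ⟨t, a, h1, h2, h3⟩ := h
  refine ⟨t, a, h1, h2, ?_⟩
  filter_upwards [h3, e] with ψ hψ e
  rw [← e, hψ]

theorem InAnalyticIdeal.zero : L.InAnalyticIdeal Z φ fun _ => 0 :=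
  ⟨∅, fun _ _ => 0, by simp, by simp, by simp⟩

theorem InAnalyticIdeal.of_mem {q : MvPolynomial (V × Fin 2) ℝ} (hq : q ∈ L.ideal Z) :
    L.InAnalyticIdeal Z φ fun ψ => MvPolynomial.eval (realCoord ψ) q :=
  ⟨{q}, fun _ _ => 1, by simpa using hq, fun _ _ => analyticAt_const, by simp⟩

theorem InAnalyticIdeal.mul {u g : (V → ℂ) → ℝ} (h : L.InAnalyticIdeal Z φ u)
    (hg : AnalyticAt ℝ g φ) : L.InAnalyticIdeal Z φ fun ψ => g ψ * u ψ := by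
  obtain ⟨t, a, h1, h2, h3⟩ := h
  refine ⟨t, fun q ψ => g ψ * a q ψ, h1, fun q hq => hg.mul (h2 q hq), ?_⟩
  filter_upwards [h3] with ψ hψ
  rw [hψ, Finset.mul_sum]
  exact Finset.sum_congr rfl fun q _ => (mul_assoc _ _ _).symm

theorem InAnalyticIdeal.add {u u' : (V → ℂ) → ℝ} (h : L.InAnalyticIdeal Z φ u)
    (h' : L.InAnalyticIdeal Z φ u') : L.InAnalyticIdeal Z φ fun ψ => u ψ + u' ψ := by
  classical
  obtain ⟨t, a, h1, h2, h3⟩ := h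
  obtain ⟨t', a', h1', h2', h3'⟩ := h'
  refine ⟨t ∪ t', fun q ψ => (if q ∈ t then a q ψ else 0) + if q ∈ t' then a' q ψ else 0, ?_, ?_, ?_⟩
  · intro q hq
    rcases Finset.mem_union.1 hq with hq | hq
    exacts [h1 q hq, h1' q hq]
  · intro q _
    refine AnalyticAt.add ?_ ?_
    · by_cases hq : q ∈ t
      · simpa [hq] using h2 q hq
      · simpa [hq] using analyticAt_const
    · by_cases hq : q ∈ t'
      · simpa [hq] using h2' q hq
      · simpa [hq] using analyticAt_const
  · filter_upwards [h3, h3'] with ψ h h'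
    rw [h, h']
    simp only [add_mul, ite_mul, zero_mul, Finset.sum_add_distrib]
    rw [Finset.sum_ite_mem, Finset.sum_ite_mem, Finset.union_inter_cancel_left,
      Finset.union_inter_cancel_right]

theorem InAnalyticIdeal.of_mul {u g : (V → ℂ) → ℝ} (h : L.InAnalyticIdeal Z φ fun ψ => g ψ * u ψ)
    (hg : AnalyticAt ℝ g φ) (h0 : g φ ≠ 0) : L.InAnalyticIdeal Z φ u := by
  refine (h.mul (hg.inv h0)).congr ?_
  filter_upwards [hg.continuousAt.eventually_ne h0] with ψ hψ
  exact inv_mul_cancel_left₀ hψ _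

/-- A vertex joined to `a` and `b` by transversal edges is determined by `a` and `b` modulo the
analytic ideal. -/
theorem InAnalyticIdeal.of_adj_of_adj {P : V} {γ : V → ℂ → ℂ} {w a b : V}
    (hγ : ∀ v, AnalyticAt ℝ (γ v) (φ P)) (hφ : ∀ v, γ v (φ P) = φ v)
    (ha : L.graph.Adj w a) (hb : L.graph.Adj w b)
    (hγa : ∀ᶠ z in 𝓝 (φ P), ‖γ w z - γ a z‖ = L.len s(w, a))
    (hγb : ∀ᶠ z in 𝓝 (φ P), ‖γ w z - γ b z‖ = L.len s(w, b))
    (hc : cross (φ w - φ a) (φ w - φ b) ≠ 0)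
    (ia : ∀ i, L.InAnalyticIdeal Z φ fun ψ => realCoord ψ (a, i) - realCoord (γ · (ψ P)) (a, i))
    (ib : ∀ i, L.InAnalyticIdeal Z φ fun ψ => realCoord ψ (b, i) - realCoord (γ · (ψ P)) (b, i))
    (i : Fin 2) :
    L.InAnalyticIdeal Z φ fun ψ => realCoord ψ (w, i) - realCoord (γ · (ψ P)) (w, i) := by
  have hproj : ∀ v, AnalyticAt ℝ (fun ψ : V → ℂ => ψ v) φ := fun v =>
    (ContinuousLinearMap.proj (R := ℝ) (φ := fun _ : V => ℂ) v).analyticAt φ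
  have hcomp : ∀ v, AnalyticAt ℝ (fun ψ : V → ℂ => γ v (ψ P)) φ := fun v =>
    AnalyticAt.fun_comp (g := γ v) (hγ v) (hproj P)
  have hn : ∀ a, AnalyticAt ℝ (fun ψ => ψ w - ψ a + (γ w (ψ P) - γ a (ψ P))) φ := fun a =>
    ((hproj w).sub (hproj a)).add ((hcomp w).sub (hcomp a))
  have key : ∀ a, L.graph.Adj w a → (∀ᶠ z in 𝓝 (φ P), ‖γ w z - γ a z‖ = L.len s(w, a)) →
      (∀ i, L.InAnalyticIdeal Z φ fun ψ => realCoord ψ (a, i) - realCoord (γ · (ψ P)) (a, i)) →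
      L.InAnalyticIdeal Z φ fun ψ =>
        (ψ w - ψ a + (γ w (ψ P) - γ a (ψ P))).re * (ψ w - γ w (ψ P)).re +
        (ψ w - ψ a + (γ w (ψ P) - γ a (ψ P))).im * (ψ w - γ w (ψ P)).im := by
    intro a ha hγa ia
    -- The edge equation holds along `γ`, so it is a difference of two squared norms, which factors
    -- as a scalar product of sum and difference. The part of the difference due to `a` is already
    -- in the ideal.
    refine ((InAnalyticIdeal.of_mem (edgeEq_mem ha)).add
      (((ia 0).mul (hn a).complex_re).add ((ia 1).mul (hn a).complex_im))).congr ?_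
    filter_upwards [(hproj P).continuousAt.eventually hγa] with ψ hψ
    rw [eval_edgeEq, ← hψ, Complex.sq_norm, Complex.sq_norm, Complex.normSq_apply,
      Complex.normSq_apply]
    simp [realCoord]
    ring
  have ka := key a ha hγa ia
  have kb := key b hb hγb ib
  have hdet : AnalyticAt ℝ (fun ψ => cross (ψ w - ψ a + (γ w (ψ P) - γ a (ψ P)))
      (ψ w - ψ b + (γ w (ψ P) - γ b (ψ P)))) φ :=
    ((hn a).complex_re.mul (hn b).complex_im).sub ((hn a).complex_im.mul (hn b).complex_re)
  have hdet0 : cross (φ w - φ a + (γ w (φ P) - γ a (φ P)))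
      (φ w - φ b + (γ w (φ P) - γ b (φ P))) ≠ 0 := by
    rw [hφ, hφ, hφ, ← two_mul, ← two_mul]
    contrapose! hc
    simp [cross] at hc ⊢
    linarith
  -- Two linear relations for the coordinates of `ψ w - γ w (ψ P)` hold modulo the ideal, with
  -- determinant invertible at `φ`; Cramer's rule solves them.
  fin_cases i
  · refine InAnalyticIdeal.of_mul (((ka.mul (hn b).complex_im).add
      (kb.mul (hn a).complex_im.neg)).congr (.of_eq (funext fun ψ => ?_))) hdet hdet0
    simp [realCoord, cross]
    ring
  · refine InAnalyticIdeal.of_mul (((ka.mul (hn b).complex_re.neg).add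
      (kb.mul (hn a).complex_re)).congr (.of_eq (funext fun ψ => ?_))) hdet hdet0
    simp [realCoord, cross]
    ring

end

end MarkedLinkage

/-! ### Elbow flips -/

/-- Elbows indexed by `H`: the vertices `x` with `index x = some i` are elbows joining the vertices
`cen i` and `tip i`, which are not elbows themselves. -/
structure Elbows (V H : Type) where
  index : V → Option H
  cen : H → V
  tip : H → V
  index_cen : ∀ i, index (cen i) = none
  index_tip : ∀ i, index (tip i) = none

namespace Elbows

variable {V H : Type} (K : Elbows V H)

/-- Reflect the elbows `i` with `τ i = -1` in the midpoint of their end points. -/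
def flip (τ : H → ℤˣ) (φ : V → ℂ) (x : V) : ℂ :=
  (K.index x).elim (φ x) fun i => if τ i = 1 then φ x else φ (K.cen i) + φ (K.tip i) - φ x

theorem flip_of_none {τ : H → ℤˣ} {φ : V → ℂ} {x : V} (h : K.index x = none) :
    K.flip τ φ x = φ x := by
  simp [flip, h]

theorem flip_of_some {τ : H → ℤˣ} {φ : V → ℂ} {x : V} {i : H} (h : K.index x = some i) :
    K.flip τ φ x = if τ i = 1 then φ x else φ (K.cen i) + φ (K.tip i) - φ x := by
  simp [flip, h]

theorem flip_cen {τ : H → ℤˣ} {φ : V → ℂ} (i : H) : K.flip τ φ (K.cen i) = φ (K.cen i) :=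
  K.flip_of_none (K.index_cen i)

theorem flip_tip {τ : H → ℤˣ} {φ : V → ℂ} (i : H) : K.flip τ φ (K.tip i) = φ (K.tip i) :=
  K.flip_of_none (K.index_tip i)

theorem flip_one (φ : V → ℂ) : K.flip 1 φ = φ := by
  funext x
  rcases h : K.index x with _ | i
  · rw [K.flip_of_none h]
  · simp [K.flip_of_some h]

theorem flip_mul (τ τ' : H → ℤˣ) (φ : V → ℂ) : K.flip (τ * τ') φ = K.flip τ (K.flip τ' φ) := by
  funext x
  rcases h : K.index x with _ | i
  · rw [K.flip_of_none h, K.flip_of_none h, K.flip_of_none h]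
  · rw [K.flip_of_some h, K.flip_of_some h, K.flip_cen, K.flip_tip, K.flip_of_some h]
    rcases Int.units_eq_one_or (τ i) with h1 | h1 <;>
      rcases Int.units_eq_one_or (τ' i) with h2 | h2 <;> simp [h1, h2]

/-- The action of the flips on an invariant set of realizations. -/
def flipHom (X : Set (V → ℂ)) (hX : ∀ τ, ∀ φ ∈ X, K.flip τ φ ∈ X) :
    (H → ℤˣ) →* Equiv.Perm X :=
  MonoidHom.toHomPerm
    { toFun := fun τ (φ : X) => (⟨K.flip τ φ, hX τ φ φ.2⟩ : X)
      map_one' := funext fun φ => Subtype.ext (K.flip_one φ)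
      map_mul' := fun τ τ' => funext fun φ => Subtype.ext (K.flip_mul τ τ' φ) }

theorem coe_flipHom {X : Set (V → ℂ)} (hX : ∀ τ, ∀ φ ∈ X, K.flip τ φ ∈ X) (τ : H → ℤˣ) (φ : X) :
    (K.flipHom X hX τ φ : V → ℂ) = K.flip τ φ := rfl

/-- The coordinates of a flip. -/
noncomputable def flipPoly (τ : H → ℤˣ) (c : V × Fin 2) : MvPolynomial (V × Fin 2) ℝ :=
  (K.index c.1).elim (MvPolynomial.X c) fun i => if τ i = 1 then MvPolynomial.X c else
    MvPolynomial.X (K.cen i, c.2) + MvPolynomial.X (K.tip i, c.2) - MvPolynomial.X c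

theorem flipPoly_of_none {τ : H → ℤˣ} {x : V} (h : K.index x = none) (k : Fin 2) :
    K.flipPoly τ (x, k) = MvPolynomial.X (x, k) := by
  simp [flipPoly, h]

theorem flipPoly_of_some {τ : H → ℤˣ} {x : V} {i : H} (h : K.index x = some i) (k : Fin 2) :
    K.flipPoly τ (x, k) = if τ i = 1 then MvPolynomial.X (x, k) else
      MvPolynomial.X (K.cen i, k) + MvPolynomial.X (K.tip i, k) - MvPolynomial.X (x, k) := by
  simp [flipPoly, h]

theorem eval_flipPoly (τ : H → ℤˣ) (φ : V → ℂ) (c : V × Fin 2) :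
    MvPolynomial.eval (realCoord φ) (K.flipPoly τ c) = realCoord (K.flip τ φ) c := by
  obtain ⟨x, k⟩ := c
  rcases h : K.index x with _ | i
  · rw [K.flipPoly_of_none h]
    simp [realCoord, K.flip_of_none h]
  · rw [K.flipPoly_of_some h]
    by_cases hτ : τ i = 1
    · simp [realCoord, K.flip_of_some h, hτ]
    · fin_cases k <;> simp [realCoord, K.flip_of_some h, hτ]

theorem isPolynomialMap_flipHom {X : Set (V → ℂ)} (hX : ∀ τ, ∀ φ ∈ X, K.flip τ φ ∈ X)
    (τ : H → ℤˣ) : IsPolynomialMap (K.flipHom X hX τ : X → X) :=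
  ⟨K.flipPoly τ, fun φ c => (K.eval_flipPoly τ φ c).symm⟩

theorem aeval_flipPoly_flipPoly (τ : H → ℤˣ) (q : MvPolynomial (V × Fin 2) ℝ) :
    MvPolynomial.aeval (K.flipPoly τ) (MvPolynomial.aeval (K.flipPoly τ) q) = q := by
  have : (MvPolynomial.aeval (K.flipPoly τ)).comp (MvPolynomial.aeval (K.flipPoly τ)) =
      AlgHom.id ℝ (MvPolynomial (V × Fin 2) ℝ) := by
    refine MvPolynomial.algHom_ext fun ⟨x, k⟩ => ?_
    rw [AlgHom.comp_apply, MvPolynomial.aeval_X, AlgHom.id_apply]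
    rcases h : K.index x with _ | i
    · rw [K.flipPoly_of_none h, MvPolynomial.aeval_X, K.flipPoly_of_none h]
    · rw [K.flipPoly_of_some h]
      by_cases hτ : τ i = 1
      · simp [hτ, K.flipPoly_of_some h]
      · simp [hτ, K.flipPoly_of_some h, K.flipPoly_of_none (K.index_cen i),
          K.flipPoly_of_none (K.index_tip i)]
  exact DFunLike.congr_fun this q

variable {s : ℕ}

/-- Each elbow has two edges of equal length, leading to its end points; the end points are not
joined, and elbows are not fixed vertices. -/
structure Compatible (L : MarkedLinkage V s) : Prop where
  adj : ∀ x y i, K.index x = some i → (L.graph.Adj x y ↔ y = K.cen i ∨ y = K.tip i)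
  len : ∀ x i, K.index x = some i → L.len s(x, K.cen i) = L.len s(x, K.tip i)
  not_adj : ∀ i, ¬ L.graph.Adj (K.cen i) (K.tip i)
  mark : ∀ j, K.index (L.mark j) = none

variable {K} {L : MarkedLinkage V s} {Z : Fin s → ℂ} (hK : K.Compatible L)

include hK

theorem Compatible.norm_flip (τ : H → ℤˣ) {φ : V → ℂ} (hφ : φ ∈ L.config Z) {x y : V}
    (h : L.graph.Adj x y) : ‖K.flip τ φ x - K.flip τ φ y‖ = L.len s(x, y) := by
  have key : ∀ x y i, K.index x = some i → L.graph.Adj x y →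
      ‖K.flip τ φ x - K.flip τ φ y‖ = L.len s(x, y) := by
    intro x y i hx h
    have hc := MarkedLinkage.norm_sub_eq hφ ((hK.adj x _ i hx).2 (Or.inl rfl))
    have ht := MarkedLinkage.norm_sub_eq hφ ((hK.adj x _ i hx).2 (Or.inr rfl))
    have hl := hK.len x i hx
    rw [K.flip_of_some hx]
    rcases (hK.adj x y i hx).1 h with rfl | rfl
    · rw [K.flip_cen]
      split_ifs
      · exact hc
      · rw [hl, ← ht, norm_sub_rev (φ x)]; congr 1; ring
    · rw [K.flip_tip]
      split_ifs
      · exact ht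
      · rw [← hl, ← hc, norm_sub_rev (φ x)]; congr 1; ring
  rcases hx : K.index x with _ | i
  · rcases hy : K.index y with _ | i
    · rw [K.flip_of_none hx, K.flip_of_none hy, MarkedLinkage.norm_sub_eq hφ h]
    · rw [norm_sub_rev, Sym2.eq_swap]; exact key y x i hy h.symm
  · exact key x y i hx h

theorem Compatible.flip_mem (τ : H → ℤˣ) (φ : V → ℂ) (hφ : φ ∈ L.config Z) :
    K.flip τ φ ∈ L.config Z :=
  ⟨fun _ _ h => by rw [hK.norm_flip τ hφ h], fun j => by rw [K.flip_of_none (hK.mark j), hφ.2 j]⟩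

theorem Compatible.aeval_edgeEq_mem (τ : H → ℤˣ) {x y : V} (h : L.graph.Adj x y) :
    MvPolynomial.aeval (K.flipPoly τ) (L.edgeEq x y) ∈ L.ideal Z := by
  have key : ∀ x y i, K.index x = some i → L.graph.Adj x y →
      MvPolynomial.aeval (K.flipPoly τ) (L.edgeEq x y) ∈ L.ideal Z := by
    intro x y i hx h
    have hc : L.edgeEq x (K.cen i) ∈ L.ideal Z :=
      MarkedLinkage.edgeEq_mem ((hK.adj x _ i hx).2 (Or.inl rfl))
    have ht : L.edgeEq x (K.tip i) ∈ L.ideal Z :=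
      MarkedLinkage.edgeEq_mem ((hK.adj x _ i hx).2 (Or.inr rfl))
    have hl := hK.len x i hx
    have nc := K.flipPoly_of_none (τ := τ) (K.index_cen i)
    have nt := K.flipPoly_of_none (τ := τ) (K.index_tip i)
    by_cases hτ : τ i = 1
    · have nx : ∀ k, K.flipPoly τ (x, k) = MvPolynomial.X (x, k) := fun k => by
        rw [K.flipPoly_of_some hx, if_pos hτ]
      rcases (hK.adj x y i hx).1 h with rfl | rfl
      · convert hc
        simp [MarkedLinkage.edgeEq, nx, nc]
      · convert ht
        simp [MarkedLinkage.edgeEq, nx, nt]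
    · have nx : ∀ k, K.flipPoly τ (x, k) = MvPolynomial.X (K.cen i, k) +
          MvPolynomial.X (K.tip i, k) - MvPolynomial.X (x, k) := fun k => by
        rw [K.flipPoly_of_some hx, if_neg hτ]
      rcases (hK.adj x y i hx).1 h with rfl | rfl
      · convert ht
        simp only [MarkedLinkage.edgeEq, map_add, map_sub, map_pow, MvPolynomial.aeval_X, nx, nc,
          MvPolynomial.algHom_C, MvPolynomial.algebraMap_eq, hl]
        ring
      · convert hc
        simp only [MarkedLinkage.edgeEq, map_add, map_sub, map_pow, MvPolynomial.aeval_X, nx, nt,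
          MvPolynomial.algHom_C, MvPolynomial.algebraMap_eq, hl]
        ring
  have comm : L.edgeEq x y = L.edgeEq y x := by
    simp only [MarkedLinkage.edgeEq, Sym2.eq_swap (a := x)]; ring
  rcases hx : K.index x with _ | i
  · rcases hy : K.index y with _ | i
    · convert MarkedLinkage.edgeEq_mem (Z := Z) h
      simp [MarkedLinkage.edgeEq, K.flipPoly_of_none hx, K.flipPoly_of_none hy]
    · rw [comm]; exact key y x i hy h.symm
  · exact key x y i hx h

/-- An elbow has only two neighbours, which are not joined. Hence no triangle contains an elbow, and
flips leave the bar equations unchanged. -/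
theorem Compatible.index_eq_none_of_triangle {x y z : V} (hxy : L.graph.Adj x y)
    (hxz : L.graph.Adj x z) (hyz : L.graph.Adj y z) : K.index x = none := by
  rcases hx : K.index x with _ | i
  · rfl
  exfalso
  rcases (hK.adj x y i hx).1 hxy with rfl | rfl <;>
    rcases (hK.adj x z i hx).1 hxz with rfl | rfl
  · exact L.graph.irrefl hyz
  · exact hK.not_adj i hyz
  · exact hK.not_adj i hyz.symm
  · exact L.graph.irrefl hyz

theorem Compatible.ideal_le (τ : H → ℤˣ) :
    L.ideal Z ≤ (L.ideal Z).comap (MvPolynomial.aeval (R := ℝ) (K.flipPoly τ)) := by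
  refine Ideal.span_le.2 ?_
  rintro q ((⟨v, w, h, rfl⟩ | ⟨j, i, rfl⟩) | ⟨a, b, c, i, h, rfl⟩)
  · exact hK.aeval_edgeEq_mem τ h
  · change MvPolynomial.aeval (K.flipPoly τ) (L.markEq Z j i) ∈ L.ideal Z
    convert MarkedLinkage.markEq_mem j i
    simp [MarkedLinkage.markEq, K.flipPoly_of_none (hK.mark j)]
  · change MvPolynomial.aeval (K.flipPoly τ) (L.barEq a b c i) ∈ L.ideal Z
    convert MarkedLinkage.barEq_mem h i
    obtain ⟨hab, hbc, hac, -⟩ := h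
    have ha := hK.index_eq_none_of_triangle hab hac hbc
    have hb := hK.index_eq_none_of_triangle hab.symm hbc hac
    have hc := hK.index_eq_none_of_triangle hac.symm hbc.symm hab
    simp [MarkedLinkage.barEq, K.flipPoly_of_none ha, K.flipPoly_of_none hb, K.flipPoly_of_none hc]

/-- The affine substitution preserves the ideal and is an involution, so the induced endomorphism of
the coordinate ring is its own inverse. -/
theorem Compatible.isSchemeAutomorphism (τ : H → ℤˣ) :
    L.IsSchemeAutomorphism Z (K.flipHom (L.config Z) (fun τ φ => hK.flip_mem τ φ) τ) := by
  let Θ := Ideal.quotientMapₐ (L.ideal Z) (MvPolynomial.aeval (R := ℝ) (K.flipPoly τ))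
    (hK.ideal_le (Z := Z) τ)
  have hΘ : Θ.comp Θ = AlgHom.id ℝ _ := by
    refine Ideal.Quotient.algHom_ext _ (AlgHom.ext fun q => ?_)
    exact congrArg (Ideal.Quotient.mk (L.ideal Z)) (K.aeval_flipPoly_flipPoly τ q)
  refine ⟨AlgEquiv.ofAlgHom Θ Θ hΘ hΘ, fun q r h φ => ?_⟩
  have h' : Ideal.Quotient.mk (L.ideal Z) (MvPolynomial.aeval (K.flipPoly τ) q) =
    Ideal.Quotient.mk (L.ideal Z) r := h
  have h0 := MarkedLinkage.eval_eq_zero φ.2 (Ideal.Quotient.eq.1 h')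
  rw [map_sub, sub_eq_zero] at h0
  rw [← h0, coe_flipHom]
  have : (MvPolynomial.eval (realCoord (φ : V → ℂ))).comp
      (MvPolynomial.aeval (R := ℝ) (K.flipPoly τ)).toRingHom =
      MvPolynomial.eval (realCoord (K.flip τ φ)) := by
    refine MvPolynomial.ringHom_ext (fun a => by simp) fun c => ?_
    simp [K.eval_flipPoly]
  exact (RingHom.congr_fun this q).symm

end Elbows

/-! ### Linkages with prescribed base realization -/

/-- The linkage on the graph `G` with the edge lengths of the realization `φ` and the set `A` of
fixed vertices. -/
noncomputable def linkageOf {V : Type} [Finite V] (G : SimpleGraph V) (φ : V → ℂ)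
    (hG : ∀ x y, G.Adj x y → φ x ≠ φ y) (A : Set V) : MarkedLinkage V (Nat.card A) where
  graph := G
  len := Sym2.lift ⟨fun x y => ‖φ x - φ y‖, fun x y => norm_sub_rev _ _⟩
  len_pos e := by
    induction e with
    | h x y => exact fun h => norm_pos_iff.2 (sub_ne_zero.2 (hG x y h))
  mark := (Finite.equivFin A).symm.toEmbedding.trans (Function.Embedding.subtype _)

section

variable {V : Type} [Finite V] {G : SimpleGraph V} {φ : V → ℂ}
  {hG : ∀ x y, G.Adj x y → φ x ≠ φ y} {A : Set V}

theorem linkageOf_mark_mem (j : Fin (Nat.card A)) : (linkageOf G φ hG A).mark j ∈ A :=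
  ((Finite.equivFin A).symm j).2

theorem exists_linkageOf_mark {v : V} (hv : v ∈ A) : ∃ j, (linkageOf G φ hG A).mark j = v :=
  ⟨Finite.equivFin A ⟨v, hv⟩, congrArg Subtype.val ((Finite.equivFin A).symm_apply_apply ⟨v, hv⟩)⟩

theorem range_linkageOf_mark : Set.range (linkageOf G φ hG A).mark = A :=
  Set.ext fun _ => ⟨fun ⟨j, hj⟩ => hj ▸ linkageOf_mark_mem j, exists_linkageOf_mark⟩

theorem mem_config_linkageOf {pos ψ : V → ℂ} :
    ψ ∈ (linkageOf G φ hG A).config (fun j => pos ((linkageOf G φ hG A).mark j)) ↔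
      (∀ x y, G.Adj x y → ‖ψ x - ψ y‖ = ‖φ x - φ y‖) ∧ ∀ v ∈ A, ψ v = pos v := by
  refine and_congr (forall₂_congr fun x y => imp_congr_right fun _ =>
    sq_eq_sq₀ (norm_nonneg _) (norm_nonneg (φ x - φ y))) ⟨fun h v hv => ?_, fun h j => h _ (linkageOf_mark_mem j)⟩
  obtain ⟨j, rfl⟩ := exists_linkageOf_mark (G := G) (φ := φ) (hG := hG) hv
  exact h j

end

/-! ### Positions of elbows -/

/-- The position of an elbow with two arms of length `3 / 2 * r` and end points `c` and `p`. -/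
noncomputable def elbowPos (σ : ℤˣ) (c p : ℂ) (r : ℝ) : ℂ :=
  (c + p) / 2 + (σ : ℤ) * (√((3 / 2 * r) ^ 2 / ‖p - c‖ ^ 2 - 1 / 4) : ℝ) * (Complex.I * (p - c))

theorem units_cast_sq (σ : ℤˣ) : ((σ : ℤ) : ℝ) ^ 2 = 1 := by
  rcases Int.units_eq_one_or σ with rfl | rfl <;> simp

theorem norm_add_mul_I_mul (d : ℂ) (a b : ℝ) :
    ‖a * d + b * (Complex.I * d)‖ ^ 2 = (a ^ 2 + b ^ 2) * ‖d‖ ^ 2 := by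
  rw [Complex.sq_norm, Complex.sq_norm, Complex.normSq_apply, Complex.normSq_apply]
  simp
  ring

theorem elbow_radicand_nonneg {c p : ℂ} {r : ℝ} (h : ‖p - c‖ ≤ 3 * r) (hne : p ≠ c) :
    0 ≤ (3 / 2 * r) ^ 2 / ‖p - c‖ ^ 2 - 1 / 4 := by
  have hd : 0 < ‖p - c‖ := norm_pos_iff.2 (sub_ne_zero.2 hne)
  rw [sub_nonneg, le_div_iff₀ (by positivity)]
  nlinarith

theorem elbow_radicand_pos {c p : ℂ} {r : ℝ} (h : ‖p - c‖ < 3 * r) (hne : p ≠ c) :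
    0 < (3 / 2 * r) ^ 2 / ‖p - c‖ ^ 2 - 1 / 4 := by
  have hd : 0 < ‖p - c‖ := norm_pos_iff.2 (sub_ne_zero.2 hne)
  rw [sub_pos, lt_div_iff₀ (by positivity)]
  nlinarith

theorem norm_elbowPos_sub {σ : ℤˣ} {c p : ℂ} {r : ℝ} (hr : 0 < r) (h : ‖p - c‖ ≤ 3 * r) (hne : p ≠ c) :
    ‖elbowPos σ c p r - c‖ = 3 / 2 * r ∧ ‖elbowPos σ c p r - p‖ = 3 / 2 * r := by
  have hd : 0 < ‖p - c‖ := norm_pos_iff.2 (sub_ne_zero.2 hne)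
  have hs := Real.sq_sqrt (elbow_radicand_nonneg h hne)
  set x := √((3 / 2 * r) ^ 2 / ‖p - c‖ ^ 2 - 1 / 4) with hx
  have key : ((1 / 2) ^ 2 + ((σ : ℤ) * x) ^ 2) * ‖p - c‖ ^ 2 = (3 / 2 * r) ^ 2 := by
    rw [mul_pow, units_cast_sq, hs]; field_simp; ring
  have e1 : elbowPos σ c p r - c =
      ((1 / 2 : ℝ) : ℂ) * (p - c) + (((σ : ℤ) * x : ℝ) : ℂ) * (Complex.I * (p - c)) := by
    rw [elbowPos, ← hx]; push_cast; ring
  have e2 : elbowPos σ c p r - p =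
      ((-(1 / 2) : ℝ) : ℂ) * (p - c) + (((σ : ℤ) * x : ℝ) : ℂ) * (Complex.I * (p - c)) := by
    rw [elbowPos, ← hx]; push_cast; ring
  constructor
  · rw [← sq_eq_sq₀ (norm_nonneg _) (by positivity), e1, norm_add_mul_I_mul, key]
  · rw [← sq_eq_sq₀ (norm_nonneg _) (by positivity), e2, norm_add_mul_I_mul, neg_sq, key]

/-- In the coordinate `q` in which the midpoint of the ends is 0 and the ends are `±1 / 2`,
equidistance means that `q` is purely imaginary; its square is then fixed by the arm length. -/
theorem exists_eq_elbowPos {c p e : ℂ} {r : ℝ} (hne : p ≠ c) (h1 : ‖e - c‖ = 3 / 2 * r)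
    (h2 : ‖e - p‖ = 3 / 2 * r) : ∃ σ, e = elbowPos σ c p r := by
  have hd0 : p - c ≠ 0 := sub_ne_zero.2 hne
  have hd : 0 < ‖p - c‖ := norm_pos_iff.2 hd0
  obtain ⟨q, hq⟩ : ∃ q : ℂ, e = (c + p) / 2 + q * (p - c) := ⟨(e - (c + p) / 2) / (p - c), by
    field_simp; ring⟩
  have e1 : e - c = (q + 1 / 2) * (p - c) := by rw [hq]; ring
  have e2 : e - p = (q - 1 / 2) * (p - c) := by rw [hq]; ring
  have n1 : Complex.normSq (q + 1 / 2) * ‖p - c‖ ^ 2 = (3 / 2 * r) ^ 2 := by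
    rw [← h1, e1, norm_mul, mul_pow, Complex.sq_norm (q + 1 / 2)]
  have n2 : Complex.normSq (q - 1 / 2) * ‖p - c‖ ^ 2 = (3 / 2 * r) ^ 2 := by
    rw [← h2, e2, norm_mul, mul_pow, Complex.sq_norm (q - 1 / 2)]
  have n3 : Complex.normSq (q + 1 / 2) = Complex.normSq (q - 1 / 2) :=
    mul_right_cancel₀ (pow_ne_zero 2 hd.ne') (n1.trans n2.symm)
  have hre : q.re = 0 := by
    simp [Complex.normSq_apply] at n3
    linarith
  have him : q.im ^ 2 = (3 / 2 * r) ^ 2 / ‖p - c‖ ^ 2 - 1 / 4 := by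
    rw [← n1, mul_div_assoc, div_self (pow_ne_zero 2 hd.ne')]
    simp [Complex.normSq_apply, hre]
    ring
  have hqi : q = q.im * Complex.I := by
    apply Complex.ext <;> simp [hre]
  rcases le_total 0 q.im with h | h
  · refine ⟨1, ?_⟩
    rw [elbowPos, ← him, Real.sqrt_sq h, hq]
    nth_rewrite 1 [hqi]
    simp; ring
  · refine ⟨-1, ?_⟩
    rw [elbowPos, ← him, Real.sqrt_sq_eq_abs, abs_of_nonpos h, hq]
    nth_rewrite 1 [hqi]
    simp; ring

theorem elbowPos_mul (σ τ : ℤˣ) (c p : ℂ) (r : ℝ) : elbowPos (τ * σ) c p r =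
    if τ = 1 then elbowPos σ c p r else c + p - elbowPos σ c p r := by
  rcases Int.units_eq_one_or τ with rfl | rfl
  · simp
  · rw [if_neg (by decide)]
    simp only [elbowPos]
    push_cast
    ring

theorem elbowPos_ne_midpoint {σ : ℤˣ} {c p : ℂ} {r : ℝ} (h : ‖p - c‖ < 3 * r) (hne : p ≠ c) :
    elbowPos σ c p r ≠ c + p - elbowPos σ c p r := by
  have hs := (Real.sqrt_pos.2 (elbow_radicand_pos h hne)).ne'
  set x := √((3 / 2 * r) ^ 2 / ‖p - c‖ ^ 2 - 1 / 4) with hx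
  intro h'
  have : ((σ : ℤ) : ℂ) * (x : ℂ) * (Complex.I * (p - c)) = 0 := by
    rw [elbowPos, ← hx] at h'
    linear_combination h' / 2
  simp [hs, sub_ne_zero.2 hne] at this

theorem cross_elbowPos_ne_zero {σ : ℤˣ} {c p : ℂ} {r : ℝ} (h : ‖p - c‖ < 3 * r) (hne : p ≠ c) :
    cross (elbowPos σ c p r - c) (elbowPos σ c p r - p) ≠ 0 := by
  have hs := (Real.sqrt_pos.2 (elbow_radicand_pos h hne)).ne'
  set x := √((3 / 2 * r) ^ 2 / ‖p - c‖ ^ 2 - 1 / 4) with hx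
  have e1 : elbowPos σ c p r - c = (1 / 2 + ((σ : ℤ) * x : ℝ) * Complex.I) * (p - c) := by
    rw [elbowPos, ← hx]; push_cast; ring
  have e2 : elbowPos σ c p r - p = (-(1 / 2) + ((σ : ℤ) * x : ℝ) * Complex.I) * (p - c) := by
    rw [elbowPos, ← hx]; push_cast; ring
  rw [e1, e2, cross_mul_mul]
  refine mul_ne_zero ?_ (by simpa [sub_eq_zero] using hne)
  have : cross (1 / 2 + ((σ : ℤ) * x : ℝ) * Complex.I) (-(1 / 2) + ((σ : ℤ) * x : ℝ) * Complex.I) =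
      (σ : ℤ) * x := by
    simp only [cross]
    simp
    ring
  rw [this]
  simp [hs]

theorem continuousAt_elbowPos {X : Type*} [TopologicalSpace X] {g : X → ℂ} {x : X} {σ : ℤˣ} {c : ℂ}
    {r : ℝ} (hg : ContinuousAt g x) (hne : g x ≠ c) :
    ContinuousAt (fun y => elbowPos σ c (g y) r) x := by
  have hd : ContinuousAt (fun y => g y - c) x := hg.sub continuousAt_const
  have hq : ContinuousAt (fun y => (3 / 2 * r) ^ 2 / ‖g y - c‖ ^ 2 - 1 / 4) x :=
    (continuousAt_const.div (hd.norm.pow 2) (by simpa [sub_eq_zero] using hne)).sub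
      continuousAt_const
  exact ((continuousAt_const.add hg).div_const _).add ((continuousAt_const.mul
    (Complex.continuous_ofReal.continuousAt.comp hq.sqrt)).mul (continuousAt_const.mul hd))

theorem analyticAt_elbowPos {E : Type*} [NormedAddCommGroup E] [NormedSpace ℝ E] {g : E → ℂ} {x : E}
    {σ : ℤˣ} {c : ℂ} {r : ℝ} (hg : AnalyticAt ℝ g x) (h : ‖g x - c‖ < 3 * r) (hne : g x ≠ c) :
    AnalyticAt ℝ (fun y => elbowPos σ c (g y) r) x := by
  have hd : AnalyticAt ℝ (fun y => g y - c) x := hg.sub analyticAt_const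
  have hn : AnalyticAt ℝ (fun y => ‖g y - c‖ ^ 2) x := by
    simp only [Complex.sq_norm, Complex.normSq_apply]
    exact (hd.complex_re.mul hd.complex_re).add (hd.complex_im.mul hd.complex_im)
  have hq : AnalyticAt ℝ (fun y => (3 / 2 * r) ^ 2 / ‖g y - c‖ ^ 2 - 1 / 4) x :=
    (analyticAt_const.div hn (by simpa [sub_eq_zero] using hne)).sub analyticAt_const
  have hs : AnalyticAt ℝ (fun y => √((3 / 2 * r) ^ 2 / ‖g y - c‖ ^ 2 - 1 / 4)) x :=
    AnalyticAt.fun_comp (g := Real.sqrt)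
      (Real.contDiffAt_sqrt (n := ⊤) (elbow_radicand_pos h hne).ne').analyticAt hq
  have h2 : AnalyticAt ℝ (fun y => (c + g y) / 2) x :=
    (analyticAt_const.add hg).div analyticAt_const two_ne_zero
  exact h2.add ((analyticAt_const.mul hs.complex_ofReal).mul (analyticAt_const.mul hd))

/-! ### Designs of linkages -/

/-- A design: positions `pos v z` of vertices depending on the position `z` of the input vertex,
where every vertex is the input vertex, an anchor, or is joined transversally to two vertices of
smaller rank. The position of `v` is confined to the disk of radius `rad v` around `mid v`. -/
structure Design (V : Type) where
  input : V
  pos : V → ℂ → ℂ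
  anchors : Set V
  fst : V → V
  snd : V → V
  rank : V → ℕ
  mid : V → ℂ
  rad : V → ℝ
  rad_pos : ∀ v, 0 < rad v
  pos_input : ∀ z, pos input z = z
  mid_input : mid input = 0
  analyticAt : ∀ v z, ‖z‖ < 3 * rad input → AnalyticAt ℝ (pos v) z
  pos_anchor : ∀ v ∈ anchors, ∀ z, ‖z‖ < 3 * rad input → pos v z = mid v
  near : ∀ v z, v ≠ input → ‖z‖ < 3 * rad input → ‖pos v z - mid v‖ < rad v
  rank_fst : ∀ v, v ≠ input → v ∉ anchors → rank (fst v) < rank v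
  rank_snd : ∀ v, v ≠ input → v ∉ anchors → rank (snd v) < rank v
  dist_fst : ∀ v, v ≠ input → v ∉ anchors → ∀ z, ‖z‖ < 3 * rad input →
    ‖pos v z - pos (fst v) z‖ = ‖pos v 0 - pos (fst v) 0‖
  dist_snd : ∀ v, v ≠ input → v ∉ anchors → ∀ z, ‖z‖ < 3 * rad input →
    ‖pos v z - pos (snd v) z‖ = ‖pos v 0 - pos (snd v) 0‖
  -- Here `w` stands for any position allowed by the hooks, whose lens lies in this disk. The
  -- condition rules out the mirror image of `pos v z` as a second solution.
  cross_ne : ∀ v, v ≠ input → v ∉ anchors → ∀ z w, ‖z‖ < 3 * rad input → ‖w - mid v‖ < 3 * rad v →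
    cross (pos v z - pos (fst v) z + (w - pos (fst v) z))
      (pos v z - pos (snd v) z + (w - pos (snd v) z)) ≠ 0

namespace Design

/-- The vertices of the linkage of a design: those of the design and, for each of them, two hooks,
consisting of a center and an elbow each. -/
abbrev Vert (V : Type) := V ⊕ (V × Bool) ⊕ (V × Bool)

/-- A vertex of the design. -/
abbrev core {V : Type} (v : V) : Vert V := Sum.inl v

/-- The center of a hook. -/
abbrev center {V : Type} (k : V × Bool) : Vert V := Sum.inr (Sum.inl k)

/-- The elbow of a hook. -/
abbrev elbow {V : Type} (k : V × Bool) : Vert V := Sum.inr (Sum.inr k)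

variable {V : Type} (D : Design V)

/-- The position of the center of a hook. -/
noncomputable def cenPos (k : V × Bool) : ℂ :=
  D.mid k.1 + (((if k.2 then 2 else -2) * D.rad k.1 : ℝ) : ℂ)

/-- The lens in which the hooks at `v` keep `v`. -/
def InLens (v : V) (w : ℂ) : Prop := ∀ i, ‖w - D.cenPos (v, i)‖ ≤ 3 * D.rad v

variable {D}

/-- Averaging the two squared distances to the centers gives `|w - mid|² + 4 * r² ≤ 9 * r²`. -/
theorem InLens.norm_lt {v : V} {w : ℂ} (h : D.InLens v w) : ‖w - D.mid v‖ < 3 * D.rad v := by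
  have hr := D.rad_pos v
  have h1 := pow_le_pow_left₀ (norm_nonneg _) (h true) 2
  have h2 := pow_le_pow_left₀ (norm_nonneg _) (h false) 2
  rw [← sq_lt_sq₀ (norm_nonneg _) (by positivity)]
  rw [Complex.sq_norm, Complex.normSq_apply] at *
  simp [cenPos] at *
  nlinarith

theorem norm_sub_cenPos_lt {v : V} {w : ℂ} (h : ‖w - D.mid v‖ < D.rad v) (i : Bool) :
    ‖w - D.cenPos (v, i)‖ < 3 * D.rad v := by
  have hr := D.rad_pos v
  have : w - D.cenPos (v, i) = (w - D.mid v) - (((if i then 2 else -2) * D.rad v : ℝ) : ℂ) := by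
    simp only [cenPos]; ring
  rw [this]
  refine (norm_sub_le _ _).trans_lt ?_
  have h2 : ‖(((if i then 2 else -2) * D.rad v : ℝ) : ℂ)‖ = 2 * D.rad v := by
    rw [Complex.norm_real, norm_mul, Real.norm_of_nonneg hr.le]
    cases i <;> simp
  linarith

theorem InLens.of_near {v : V} {w : ℂ} (h : ‖w - D.mid v‖ < D.rad v) : D.InLens v w :=
  fun i => (norm_sub_cenPos_lt h i).le

/-- Each center is at distance `4 * r` from the other, outside the lens. This is why two hooks are
used: with `v` at the center of a hook, its elbow could turn freely. -/
theorem InLens.ne_cenPos {v : V} {w : ℂ} (h : D.InLens v w) (i : Bool) : w ≠ D.cenPos (v, i) := by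
  rintro rfl
  have hr := D.rad_pos v
  have := h (!i)
  have e : D.cenPos (v, i) - D.cenPos (v, !i) = (((if i then 4 else -4) * D.rad v : ℝ) : ℂ) := by
    cases i <;> simp [cenPos] <;> ring
  rw [e, Complex.norm_real, norm_mul, Real.norm_of_nonneg hr.le] at this
  cases i <;> norm_num at this <;> linarith

theorem InLens.norm_input_lt {z : ℂ} (h : D.InLens D.input z) : ‖z‖ < 3 * D.rad D.input := by
  simpa [D.mid_input] using h.norm_lt

theorem inLens_pos {z : ℂ} (hz : D.InLens D.input z) (v : V) : D.InLens v (D.pos v z) := by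
  by_cases h : v = D.input
  · rw [h, D.pos_input]; exact hz
  · exact .of_near (D.near v z h hz.norm_input_lt)

theorem inLens_input {z : ℂ} (h : ‖z‖ < D.rad D.input) : D.InLens D.input z :=
  .of_near (by simpa [D.mid_input] using h)

theorem norm_pos_sub_cenPos_lt {z : ℂ} (h : ∀ i, ‖z - D.cenPos (D.input, i)‖ < 3 * D.rad D.input)
    (k : V × Bool) : ‖D.pos k.1 z - D.cenPos k‖ < 3 * D.rad k.1 := by
  obtain ⟨v, i⟩ := k
  by_cases hv : v = D.input
  · subst hv; rw [D.pos_input]; exact h i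
  · have hz : D.InLens D.input z := fun i => (h i).le
    exact norm_sub_cenPos_lt (D.near v z hv hz.norm_input_lt) i

variable (D)

/-- The realization over `z` with signs `s`. -/
noncomputable def section_ (s : V × Bool → ℤˣ) (z : ℂ) : Vert V → ℂ
  | Sum.inl v => D.pos v z
  | Sum.inr (Sum.inl k) => D.cenPos k
  | Sum.inr (Sum.inr k) => elbowPos (s k) (D.cenPos k) (D.pos k.1 z) (D.rad k.1)

/-- The edges of the linkage of a design. -/
inductive Joins : Vert V → Vert V → Prop
  | fst (v : V) : v ≠ D.input → v ∉ D.anchors → Joins (core v) (core (D.fst v))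
  | snd (v : V) : v ≠ D.input → v ∉ D.anchors → Joins (core v) (core (D.snd v))
  | center (k : V × Bool) : Joins (elbow k) (center k)
  | tip (k : V × Bool) : Joins (elbow k) (core k.1)

/-- The graph of the linkage of a design. -/
def graph : SimpleGraph (Vert V) := SimpleGraph.fromRel D.Joins

/-- The base realization. -/
noncomputable def base : Vert V → ℂ := D.section_ 1 0

variable {D}

theorem inLens_zero : D.InLens D.input 0 := inLens_input (by simpa using D.rad_pos _)

theorem norm_zero_lt : ‖(0 : ℂ)‖ < 3 * D.rad D.input := inLens_zero.norm_input_lt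

theorem norm_elbow_sub {z : ℂ} (hz : D.InLens D.input z) (s : V × Bool → ℤˣ) (k : V × Bool) :
    ‖D.section_ s z (elbow k) - D.section_ s z (center k)‖ = 3 / 2 * D.rad k.1 ∧
    ‖D.section_ s z (elbow k) - D.section_ s z (core k.1)‖ = 3 / 2 * D.rad k.1 :=
  norm_elbowPos_sub (D.rad_pos _) (inLens_pos hz k.1 k.2) ((inLens_pos hz k.1).ne_cenPos k.2)

theorem cross_pos_ne {v : V} (h1 : v ≠ D.input) (h2 : v ∉ D.anchors) {z : ℂ}
    (hz : ‖z‖ < 3 * D.rad D.input) :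
    cross (D.pos v z - D.pos (D.fst v) z) (D.pos v z - D.pos (D.snd v) z) ≠ 0 := by
  have := D.cross_ne v h1 h2 z (D.pos v z) hz (by
    have := D.near v z h1 hz
    have := D.rad_pos v
    linarith)
  contrapose! this
  simp [cross] at this ⊢
  linarith

theorem cross_zero_left (x : ℂ) : cross 0 x = 0 := by simp [cross]

theorem cross_zero_right (x : ℂ) : cross x 0 = 0 := by simp [cross]

theorem Joins.base_ne {x y : Vert V} (h : D.Joins x y) : D.base x ≠ D.base y := by
  intro he
  cases h with
  | fst v h1 h2 =>
    refine cross_pos_ne h1 h2 norm_zero_lt ?_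
    rw [sub_eq_zero.2 (show D.pos v 0 = D.pos (D.fst v) 0 from he), cross_zero_left]
  | snd v h1 h2 =>
    refine cross_pos_ne h1 h2 norm_zero_lt ?_
    rw [sub_eq_zero.2 (show D.pos v 0 = D.pos (D.snd v) 0 from he), cross_zero_right]
  | center k =>
    have : ‖D.base (elbow k) - D.base (Design.center k)‖ = _ := (norm_elbow_sub inLens_zero 1 k).1
    have hr := D.rad_pos k.1
    rw [sub_eq_zero.2 he, norm_zero] at this
    linarith
  | tip k =>
    have : ‖D.base (elbow k) - D.base (core k.1)‖ = _ := (norm_elbow_sub inLens_zero 1 k).2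
    have hr := D.rad_pos k.1
    rw [sub_eq_zero.2 he, norm_zero] at this
    linarith

theorem Joins.adj {x y : Vert V} (h : D.Joins x y) : D.graph.Adj x y :=
  (SimpleGraph.fromRel_adj _ _ _).2 ⟨fun e => h.base_ne (congrArg _ e), Or.inl h⟩

theorem base_ne_of_adj {x y : Vert V} (h : D.graph.Adj x y) : D.base x ≠ D.base y := by
  rcases ((SimpleGraph.fromRel_adj _ _ _).1 h).2 with h | h
  exacts [h.base_ne, h.base_ne.symm]

/-! ### Realizations are determined by the input and the signs of the elbows -/

variable (D)

/-- The realizations of the linkage of a design. -/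
structure IsRealization (φ : Vert V → ℂ) : Prop where
  norm_sub : ∀ x y, D.Joins x y → ‖φ x - φ y‖ = ‖D.base x - D.base y‖
  anchor : ∀ v ∈ D.anchors, φ (core v) = D.mid v
  center : ∀ k, φ (center k) = D.cenPos k

variable {D}

theorem isRealization_section {z : ℂ} (hz : D.InLens D.input z) (s : V × Bool → ℤˣ) :
    D.IsRealization (D.section_ s z) where
  norm_sub x y h := by
    cases h with
    | fst v h1 h2 => exact D.dist_fst v h1 h2 z hz.norm_input_lt
    | snd v h1 h2 => exact D.dist_snd v h1 h2 z hz.norm_input_lt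
    | center k =>
      exact (norm_elbow_sub hz s k).1.trans (norm_elbow_sub inLens_zero 1 k).1.symm
    | tip k =>
      exact (norm_elbow_sub hz s k).2.trans (norm_elbow_sub inLens_zero 1 k).2.symm
  anchor v hv := D.pos_anchor v hv z hz.norm_input_lt
  center k := rfl

/-- Two points at the same distances from `a` and `b` coincide unless they are symmetric with
respect to the line through `a` and `b`. -/
theorem eq_of_norm_eq_of_cross_ne {a b w w' : ℂ} (ha : ‖w - a‖ = ‖w' - a‖) (hb : ‖w - b‖ = ‖w' - b‖)
    (h : cross (w - a + (w' - a)) (w - b + (w' - b)) ≠ 0) : w' = w := by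
  -- Each equality of distances says that `w' - w` is orthogonal to one of the two vectors in `h`;
  -- these are linearly independent.
  have ha2 := congrArg (· ^ 2) ha
  have hb2 := congrArg (· ^ 2) hb
  simp only [Complex.sq_norm, Complex.normSq_apply, Complex.sub_re, Complex.sub_im] at ha2 hb2
  simp only [cross, Complex.add_re, Complex.add_im, Complex.sub_re, Complex.sub_im] at h
  apply Complex.ext
  · refine mul_left_cancel₀ h ?_
    linear_combination (w.im - b.im + (w'.im - b.im)) * (-ha2) + (w.im - a.im + (w'.im - a.im)) * hb2
  · refine mul_left_cancel₀ h ?_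
    linear_combination (w.re - b.re + (w'.re - b.re)) * ha2 - (w.re - a.re + (w'.re - a.re)) * hb2

namespace IsRealization

variable {φ : Vert V → ℂ} (hφ : D.IsRealization φ)

include hφ

theorem norm_elbow_sub (k : V × Bool) : ‖φ (elbow k) - D.cenPos k‖ = 3 / 2 * D.rad k.1 ∧
    ‖φ (elbow k) - φ (core k.1)‖ = 3 / 2 * D.rad k.1 := by
  constructor
  · rw [← hφ.center, hφ.norm_sub _ _ (.center k)]
    exact (Design.norm_elbow_sub inLens_zero 1 k).1
  · rw [hφ.norm_sub _ _ (.tip k)]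
    exact (Design.norm_elbow_sub inLens_zero 1 k).2

theorem inLens (v : V) : D.InLens v (φ (core v)) := by
  intro i
  have h := hφ.norm_elbow_sub (v, i)
  calc ‖φ (core v) - D.cenPos (v, i)‖
      ≤ ‖φ (core v) - φ (elbow (v, i))‖ + ‖φ (elbow (v, i)) - D.cenPos (v, i)‖ :=
        norm_sub_le_norm_sub_add_norm_sub _ _ _
    _ = 3 * D.rad v := by rw [norm_sub_rev, h.1, h.2]; ring

theorem norm_input_lt : ‖φ (core D.input)‖ < 3 * D.rad D.input := (hφ.inLens _).norm_input_lt

/-- Induction on the rank: the two parents are in their prescribed positions, and the hooks exclude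
the mirror image. -/
theorem core_eq (v : V) : φ (core v) = D.pos v (φ (core D.input)) := by
  induction hn : D.rank v using Nat.strong_induction_on generalizing v with
  | _ n ih =>
    by_cases h1 : v = D.input
    · rw [h1, D.pos_input]
    by_cases h2 : v ∈ D.anchors
    · rw [hφ.anchor v h2, D.pos_anchor v h2 _ hφ.norm_input_lt]
    have ef := ih _ (hn ▸ D.rank_fst v h1 h2) _ rfl
    have es := ih _ (hn ▸ D.rank_snd v h1 h2) _ rfl
    refine eq_of_norm_eq_of_cross_ne ?_ ?_
      (D.cross_ne v h1 h2 _ _ hφ.norm_input_lt (hφ.inLens v).norm_lt)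
    · rw [D.dist_fst v h1 h2 _ hφ.norm_input_lt, ← ef]
      exact (hφ.norm_sub _ _ (.fst v h1 h2)).symm
    · rw [D.dist_snd v h1 h2 _ hφ.norm_input_lt, ← es]
      exact (hφ.norm_sub _ _ (.snd v h1 h2)).symm

theorem exists_eq_section : ∃ s, φ = D.section_ s (φ (core D.input)) := by
  have h : ∀ k : V × Bool, ∃ σ, φ (elbow k) =
      elbowPos σ (D.cenPos k) (D.pos k.1 (φ (core D.input))) (D.rad k.1) := by
    intro k
    have h := hφ.norm_elbow_sub k
    rw [← hφ.core_eq]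
    exact exists_eq_elbowPos ((hφ.inLens k.1).ne_cenPos k.2) h.1 h.2
  choose s hs using h
  refine ⟨s, funext fun x => ?_⟩
  rcases x with v | k | k
  exacts [hφ.core_eq v, hφ.center k, hs k]

end IsRealization

theorem continuousAt_section {z : ℂ} (hz : D.InLens D.input z) (s : V × Bool → ℤˣ) :
    ContinuousAt (D.section_ s) z := by
  refine continuousAt_pi.2 fun x => ?_
  rcases x with v | k | k
  · exact (D.analyticAt v z hz.norm_input_lt).continuousAt
  · exact continuousAt_const
  · exact continuousAt_elbowPos (D.analyticAt k.1 z hz.norm_input_lt).continuousAt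
      ((inLens_pos hz k.1).ne_cenPos k.2)

theorem analyticAt_section {z : ℂ} (hz : ‖z‖ < D.rad D.input) (s : V × Bool → ℤˣ) (x : Vert V) :
    AnalyticAt ℝ (fun z => D.section_ s z x) z := by
  have hl := inLens_input hz
  rcases x with v | k | k
  · exact D.analyticAt v z hl.norm_input_lt
  · exact analyticAt_const
  · refine analyticAt_elbowPos (D.analyticAt k.1 z hl.norm_input_lt) ?_
      ((inLens_pos hl k.1).ne_cenPos k.2)
    exact norm_pos_sub_cenPos_lt (norm_sub_cenPos_lt (by simpa [D.mid_input] using hz)) k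

theorem norm_input_cenPos (i : Bool) : ‖D.cenPos (D.input, i)‖ = 2 * D.rad D.input := by
  have hr := D.rad_pos D.input
  rw [cenPos, D.mid_input, zero_add, Complex.norm_real, norm_mul, Real.norm_of_nonneg hr.le]
  cases i <;> simp

/-- Shrinking toward 0 moves the input strictly inside its lens, since 0 is only `2 * r` away from
the centers. -/
theorem norm_smul_sub_cenPos_lt {z : ℂ} (hz : D.InLens D.input z) {t : ℝ} (h0 : 0 < t) (h1 : t < 1)
    (i : Bool) : ‖(1 - t) * z - D.cenPos (D.input, i)‖ < 3 * D.rad D.input := by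
  have hr := D.rad_pos D.input
  have e : (1 - t) * z - D.cenPos (D.input, i) = ((1 - t : ℝ) : ℂ) * (z - D.cenPos (D.input, i)) -
      (t : ℂ) * D.cenPos (D.input, i) := by push_cast; ring
  rw [e]
  refine (norm_sub_le _ _).trans_lt ?_
  rw [norm_mul, norm_mul, Complex.norm_real, Complex.norm_real, norm_input_cenPos,
    Real.norm_of_nonneg h0.le, Real.norm_of_nonneg (by linarith)]
  have := mul_le_mul_of_nonneg_left (hz i) (by linarith : 0 ≤ 1 - t)
  nlinarith

/-! ### Flips of the hooks -/

variable (V)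

/-- The elbows of the hooks of a design. -/
def hooks : Elbows (Vert V) (V × Bool) where
  index := Sum.elim (fun _ => none) (Sum.elim (fun _ => none) some)
  cen := center
  tip k := core k.1
  index_cen _ := rfl
  index_tip _ := rfl

/-- The elbows of the hooks of a design, in the presence of an additional vertex. -/
def hooksOption : Elbows (Option (Vert V)) (V × Bool) where
  index o := o.elim none (hooks V).index
  cen k := some (center k)
  tip k := some (core k.1)
  index_cen _ := rfl
  index_tip _ := rfl

variable {V}

theorem hooks_flip_section (s τ : V × Bool → ℤˣ) (z : ℂ) :
    (hooks V).flip τ (D.section_ s z) = D.section_ (τ * s) z := by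
  funext x
  rcases x with v | k | k
  · rfl
  · rfl
  · exact (elbowPos_mul _ _ _ _ _).symm

theorem hooksOption_flip (τ : V × Bool → ℤˣ) (φ : Option (Vert V) → ℂ) (o : Option (Vert V)) :
    (hooksOption V).flip τ φ o = o.elim (φ none) ((hooks V).flip τ (φ ∘ some)) := by
  rcases o with _ | v | k | k <;> rfl

theorem adj_elbow_iff {k : V × Bool} {y : Vert V} :
    D.graph.Adj (elbow k) y ↔ y = center k ∨ y = core k.1 := by
  constructor
  · intro h
    rcases ((SimpleGraph.fromRel_adj _ _ _).1 h).2 with h | h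
    · cases h with
      | center => exact Or.inl rfl
      | tip => exact Or.inr rfl
    · cases h
  · rintro (rfl | rfl)
    exacts [(Joins.center k).adj, (Joins.tip k).adj]

theorem not_adj_center_core {k : V × Bool} {v : V} : ¬ D.graph.Adj (center k) (core v) := by
  intro h
  rcases ((SimpleGraph.fromRel_adj _ _ _).1 h).2 with h | h <;> cases h

end Design

namespace Design

variable {V : Type} (D : Design V)

/-! ### The open linkage of a design -/

/-- The fixed vertices of the linkage of a design. -/
def fixedVerts : Set (Vert V) := core '' D.anchors ∪ Set.range center

/-- The realization over `z` with signs `s`, and an additional vertex at `t`. -/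
noncomputable def extSection (t : ℂ) (s : V × Bool → ℤˣ) (z : ℂ) (o : Option (Vert V)) : ℂ :=
  o.elim t (D.section_ s z)

theorem extSection_ne_of_adj (t : ℂ) (x y : Option (Vert V))
    (h : (D.graph.map (Function.Embedding.some : Vert V ↪ Option (Vert V))).Adj x y) :
    D.extSection t 1 0 x ≠ D.extSection t 1 0 y := by
  obtain ⟨x, y, h', rfl, rfl⟩ := (SimpleGraph.map_adj _ _ _ _).1 h
  exact base_ne_of_adj h'

variable {D} {t : ℂ}

theorem norm_sub_eq_of_adj {φ : Vert V → ℂ} (hφ : D.IsRealization φ) {x y : Vert V}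
    (h : D.graph.Adj x y) : ‖φ x - φ y‖ = ‖D.base x - D.base y‖ := by
  rcases ((SimpleGraph.fromRel_adj _ _ _).1 h).2 with h | h
  · exact hφ.norm_sub x y h
  · rw [norm_sub_rev, hφ.norm_sub y x h, norm_sub_rev]

theorem base_anchor {v : V} (hv : v ∈ D.anchors) : D.base (core v) = D.mid v :=
  D.pos_anchor v hv 0 norm_zero_lt

theorem isRealization_iff {φ : Vert V → ℂ} : D.IsRealization φ ↔
    (∀ x y, D.graph.Adj x y → ‖φ x - φ y‖ = ‖D.base x - D.base y‖) ∧
      ∀ x ∈ D.fixedVerts, φ x = D.base x := by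
  constructor
  · refine fun h => ⟨fun x y => norm_sub_eq_of_adj h, ?_⟩
    rintro _ (⟨v, hv, rfl⟩ | ⟨k, rfl⟩)
    · rw [h.anchor v hv, base_anchor hv]
    · exact h.center k
  · refine fun h => ⟨fun x y hxy => h.1 x y hxy.adj, fun v hv => ?_, fun k => ?_⟩
    · rw [h.2 _ (Or.inl ⟨v, hv, rfl⟩), base_anchor hv]
    · exact h.2 _ (Or.inr ⟨k, rfl⟩)

theorem extSection_input (s : V × Bool → ℤˣ) (z : ℂ) :
    D.extSection t s z (some (core D.input)) = z := D.pos_input z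

theorem continuousAt_extSection {z : ℂ} (hz : D.InLens D.input z) (s : V × Bool → ℤˣ) :
    ContinuousAt (D.extSection t s) z := by
  refine continuousAt_pi.2 fun o => ?_
  rcases o with _ | x
  exacts [continuousAt_const, continuousAt_pi.1 (continuousAt_section hz s) x]

theorem hooksOption_flip_extSection (s τ : V × Bool → ℤˣ) (z : ℂ) :
    (hooksOption V).flip τ (D.extSection t s z) = D.extSection t (τ * s) z := by
  funext o
  rw [hooksOption_flip]
  rcases o with _ | x
  · rfl
  · exact congrFun (hooks_flip_section s τ z) x

theorem elbow_ne_of_lt {z : ℂ} (hz : ∀ i, ‖z - D.cenPos (D.input, i)‖ < 3 * D.rad D.input)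
    (s : V × Bool → ℤˣ) (k : V × Bool) : D.section_ s z (elbow k) ≠
      D.section_ s z (center k) + D.section_ s z (core k.1) - D.section_ s z (elbow k) :=
  elbowPos_ne_midpoint (norm_pos_sub_cenPos_lt hz k)
    ((inLens_pos (fun i => (hz i).le) k.1).ne_cenPos k.2)

variable [Fintype V]

/-- The linkage of a design, with an isolated fixed vertex at `t`. -/
noncomputable def link (D : Design V) (t : ℂ) : MarkedLinkage (Option (Vert V))
    (Nat.card (insert none (some '' D.fixedVerts) : Set (Option (Vert V)))) :=
  linkageOf (D.graph.map Function.Embedding.some) (D.extSection t 1 0) (D.extSection_ne_of_adj t)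
    (insert none (some '' D.fixedVerts))

/-- The positions of the fixed vertices of `link`. -/
noncomputable def linkPos (D : Design V) (t : ℂ)
    (j : Fin (Nat.card (insert none (some '' D.fixedVerts) : Set (Option (Vert V))))) : ℂ :=
  D.extSection t 1 0 ((D.link t).mark j)

theorem link_adj {x y : Vert V} :
    (D.link t).graph.Adj (some x) (some y) ↔ D.graph.Adj x y :=
  SimpleGraph.map_adj_apply (f := Function.Embedding.some)

theorem link_adj_iff {x y : Option (Vert V)} :
    (D.link t).graph.Adj x y ↔ ∃ x' y', D.graph.Adj x' y' ∧ some x' = x ∧ some y' = y :=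
  SimpleGraph.map_adj _ _ _ _

theorem mem_config_link {φ : Option (Vert V) → ℂ} :
    φ ∈ (D.link t).config (D.linkPos t) ↔ D.IsRealization (φ ∘ some) ∧ φ none = t := by
  refine (mem_config_linkageOf (pos := D.extSection t 1 0)).trans ?_
  rw [isRealization_iff]
  constructor
  · exact fun h => ⟨⟨fun x y hxy => h.1 _ _ ((link_adj (t := t)).2 hxy),
      fun x hx => h.2 _ (Or.inr ⟨x, hx, rfl⟩)⟩, h.2 none (Or.inl rfl)⟩
  · refine fun h => ⟨fun x y hxy => ?_, ?_⟩
    · obtain ⟨x, y, hxy', rfl, rfl⟩ := (link_adj_iff (t := t)).1 hxy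
      exact h.1.1 x y hxy'
    · rintro _ (rfl | ⟨x, hx, rfl⟩)
      exacts [h.2, h.1.2 x hx]

theorem extSection_mem {z : ℂ} (hz : D.InLens D.input z) (s : V × Bool → ℤˣ) :
    D.extSection t s z ∈ (D.link t).config (D.linkPos t) :=
  mem_config_link.2 ⟨isRealization_section hz s, rfl⟩

theorem exists_eq_extSection {φ : Option (Vert V) → ℂ}
    (hφ : φ ∈ (D.link t).config (D.linkPos t)) :
    D.InLens D.input (φ (some (core D.input))) ∧
      ∃ s, φ = D.extSection t s (φ (some (core D.input))) := by
  obtain ⟨h, h'⟩ := mem_config_link.1 hφ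
  obtain ⟨s, hs⟩ := h.exists_eq_section
  refine ⟨h.inLens D.input, s, funext fun o => ?_⟩
  rcases o with _ | x
  exacts [h', congrFun hs x]

theorem compatible_link (t : ℂ) : (hooksOption V).Compatible (D.link t) where
  adj x y k h := by
    rcases x with _ | x | x | x
    · exact absurd h (by simp [hooksOption])
    · exact absurd h (by simp [hooksOption, hooks])
    · exact absurd h (by simp [hooksOption, hooks])
    · obtain rfl : x = k := Option.some.inj h
      rcases y with _ | y
      · rw [link_adj_iff]
        simp [hooksOption]
      · rw [link_adj, adj_elbow_iff]
        simp [hooksOption]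
  len x k h := by
    rcases x with _ | x | x | x
    · exact absurd h (by simp [hooksOption])
    · exact absurd h (by simp [hooksOption, hooks])
    · exact absurd h (by simp [hooksOption, hooks])
    · obtain rfl : x = k := Option.some.inj h
      have := norm_elbow_sub (D := D) inLens_zero 1 x
      exact (this.1.trans this.2.symm)
  not_adj k h := not_adj_center_core (link_adj.1 h)
  mark j := by
    have := linkageOf_mark_mem (hG := D.extSection_ne_of_adj t)
      (A := insert none (some '' D.fixedVerts)) j
    change (hooksOption V).index ((D.link t).mark j) = none
    change (D.link t).mark j ∈ _ at this
    rcases this with h | ⟨x, ⟨v, -, rfl⟩ | ⟨k, rfl⟩, h⟩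
    · rw [h]; rfl
    · rw [← h]; rfl
    · rw [← h]; rfl

/-- The group of flips of the hooks, acting on the configuration space. -/
noncomputable def flipGroup (D : Design V) (t : ℂ) :
    Subgroup (Equiv.Perm ((D.link t).config (D.linkPos t))) :=
  ((hooksOption V).flipHom _ fun τ φ => (compatible_link t).flip_mem τ φ).range

/-- A fixed elbow is stretched straight. Moving the input slightly toward 0, with the same signs,
bends all elbows, so this closed set has no interior. -/
theorem isNowhereDense_elbow (k : V × Bool) :
    IsNowhereDense {φ : (D.link t).config (D.linkPos t) |
      (φ : Option (Vert V) → ℂ) (some (elbow k)) =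
        (φ : Option (Vert V) → ℂ) (some (center k)) + (φ : Option (Vert V) → ℂ) (some (core k.1)) -
          (φ : Option (Vert V) → ℂ) (some (elbow k))} := by
  have hc : ∀ o : Option (Vert V), Continuous fun φ : (D.link t).config (D.linkPos t) =>
      (φ : Option (Vert V) → ℂ) o := fun o => (continuous_apply o).comp continuous_subtype_val
  rw [(isClosed_eq (hc (some (elbow k))) (((hc (some (center k))).fun_add
    (hc (some (core k.1)))).fun_sub (hc (some (elbow k))))).isNowhereDense_iff,
    Set.eq_empty_iff_forall_notMem]
  intro φ hφ
  obtain ⟨N, hN, hN'⟩ := isOpen_induced_iff.1 (isOpen_interior (s :=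
    {φ : (D.link t).config (D.linkPos t) | (φ : Option (Vert V) → ℂ) (some (elbow k)) =
        (φ : Option (Vert V) → ℂ) (some (center k)) + (φ : Option (Vert V) → ℂ) (some (core k.1)) -
          (φ : Option (Vert V) → ℂ) (some (elbow k))}))
  have hφN : (φ : Option (Vert V) → ℂ) ∈ N := by
    have := hN'.symm ▸ hφ
    exact this
  obtain ⟨hz, s, hs⟩ := exists_eq_extSection φ.2
  set z := (φ : Option (Vert V) → ℂ) (some (core D.input)) with hzdef
  have hcont : ContinuousAt (fun r : ℝ => D.extSection t s ((1 - r) * z)) 0 := by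
    refine ContinuousAt.comp (g := D.extSection t s) (f := fun r : ℝ => (1 - (r : ℂ)) * z) ?_ ?_
    · simpa using continuousAt_extSection hz s
    · fun_prop
  have hev : ∀ᶠ r : ℝ in 𝓝[>] 0, D.extSection t s ((1 - r) * z) ∈ N := by
    refine nhdsWithin_le_nhds (hcont.eventually_mem (hN.mem_nhds ?_))
    simpa [← hs] using hφN
  obtain ⟨r, hr, hr0, hr1⟩ := (hev.and (Ioo_mem_nhdsGT (zero_lt_one' ℝ))).exists
  have hlt := norm_smul_sub_cenPos_lt hz hr0 hr1
  have hmem := extSection_mem (t := t) (fun i => (hlt i).le) s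
  have hint : (⟨_, hmem⟩ : (D.link t).config (D.linkPos t)) ∈ Subtype.val ⁻¹' N := hr
  rw [hN'] at hint
  have hmid := interior_subset hint
  exact elbow_ne_of_lt hlt s k hmid

theorem isRegularBranchedCovering_link (D : Design V) (t : ℂ) :
    (D.link t).IsRegularBranchedCovering (D.linkPos t) (fun _ : Fin 1 => some (core D.input))
      (flipGroup D t) where
  finite := Finite.of_surjective _ (MonoidHom.rangeRestrict_surjective _)
  scheme := by
    rintro _ ⟨τ, rfl⟩
    exact (compatible_link t).isSchemeAutomorphism τ
  fibers φ ψ := by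
    obtain ⟨hz, s, hs⟩ := exists_eq_extSection φ.2
    obtain ⟨hz', s', hs'⟩ := exists_eq_extSection ψ.2
    constructor
    · intro h
      have h0 := congrFun h 0
      simp only [positions] at h0
      refine ⟨_, ⟨s' * s⁻¹, rfl⟩, Subtype.ext ?_⟩
      rw [Elbows.coe_flipHom, hs, hooksOption_flip_extSection, inv_mul_cancel_right, h0, ← hs']
    · rintro ⟨_, ⟨τ, rfl⟩, rfl⟩
      funext i
      rfl
  quotient := by
    have hrange : ∀ x ∈ Set.range fun φ : (D.link t).config (D.linkPos t) =>
        positions (fun _ : Fin 1 => some (core D.input)) (φ : Option (Vert V) → ℂ),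
        D.InLens D.input (x 0) := by
      rintro _ ⟨φ, rfl⟩
      exact (exists_eq_extSection φ.2).1
    -- The realizations with all signs 1 form a continuous section over the image, even at the
    -- branch points.
    refine IsQuotientMap.of_inverse (f := fun x => (⟨D.extSection t 1 (x.1 0),
      extSection_mem (hrange _ x.2) 1⟩ : (D.link t).config (D.linkPos t))) ?_ ?_ ?_
    · refine Continuous.subtype_mk (continuous_iff_continuousAt.2 fun x => ?_) _
      refine ContinuousAt.comp (g := D.extSection t 1) (continuousAt_extSection (hrange _ x.2) 1) ?_
      exact ((continuous_apply 0).comp continuous_subtype_val).continuousAt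
    · refine Continuous.subtype_mk (continuous_pi fun i => ?_) _
      exact (continuous_apply _).comp continuous_subtype_val
    · intro x
      refine Subtype.ext (funext fun i => ?_)
      rw [Subsingleton.elim i 0]
      exact extSection_input (t := t) 1 _
  walls := by
    rintro _ ⟨τ, rfl⟩ hτ
    obtain ⟨k, hk⟩ : ∃ k, τ k ≠ 1 := by
      by_contra! h
      exact hτ (by rw [show τ = 1 from funext h, map_one])
    refine (isNowhereDense_elbow k).mono fun φ hφ => ?_
    have h := congrFun (congrArg Subtype.val (show _ = φ from hφ)) (some (elbow k))
    rw [Elbows.coe_flipHom, Elbows.flip_of_some (hooksOption V) (i := k) rfl, if_neg hk] at h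
    exact h.symm

/-- Fixed vertices are handled by their marking equations, the input is trivial, and all other
vertices follow by transversal intersection, by induction on the rank and finally for the elbows. -/
theorem inAnalyticIdeal_link (t : ℂ) (c : Option (Vert V) × Fin 2) :
    (D.link t).InAnalyticIdeal (D.linkPos t) (D.extSection t 1 0) fun ψ =>
      realCoord ψ c - realCoord (D.extSection t 1 (ψ (some (core D.input)))) c := by
  have h0 : D.extSection t 1 0 (some (core D.input)) = 0 := extSection_input (t := t) 1 0
  have hproj : ContinuousAt (fun ψ : Option (Vert V) → ℂ => ψ (some (core D.input)))
    (D.extSection t 1 0) := (continuous_apply _).continuousAt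
  have hnorm : ∀ᶠ z : ℂ in 𝓝 0, ‖z‖ < D.rad D.input :=
    (continuous_norm.tendsto' (0 : ℂ) 0 norm_zero).eventually_lt_const (D.rad_pos _)
  have han : ∀ o, AnalyticAt ℝ (fun z => D.extSection t 1 z o) 0 := by
    rintro (_ | x)
    exacts [analyticAt_const, analyticAt_section (by simpa using D.rad_pos _) 1 x]
  have hfix : ∀ o ∈ (insert none (some '' D.fixedVerts) : Set (Option (Vert V))), ∀ i,
      (D.link t).InAnalyticIdeal (D.linkPos t) (D.extSection t 1 0) fun ψ =>
        realCoord ψ (o, i) - realCoord (D.extSection t 1 (ψ (some (core D.input)))) (o, i) := by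
    intro o ho i
    obtain ⟨j, hj⟩ : ∃ j, (D.link t).mark j = o := exists_linkageOf_mark ho
    refine (MarkedLinkage.InAnalyticIdeal.of_mem (MarkedLinkage.markEq_mem j i)).congr ?_
    rw [← h0] at hnorm
    filter_upwards [hproj.eventually hnorm] with ψ hψ
    have h1 := (mem_config_linkageOf (pos := D.extSection t 1 0)).1
      (extSection_mem (t := t) (inLens_input hψ) 1)
    have e : D.extSection t 1 (ψ (some (core D.input))) o = D.linkPos t j := by
      rw [h1.2 o ho, linkPos, hj]
    subst hj
    fin_cases i
    · simpa [MarkedLinkage.markEq, realCoord] using congrArg Complex.re e.symm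
    · simpa [MarkedLinkage.markEq, realCoord] using congrArg Complex.im e.symm
  have hcirc : ∀ w a b : Vert V, D.graph.Adj w a → D.graph.Adj w b →
      cross (D.base w - D.base a) (D.base w - D.base b) ≠ 0 →
      (∀ i, (D.link t).InAnalyticIdeal (D.linkPos t) (D.extSection t 1 0) fun ψ =>
        realCoord ψ (some a, i) -
          realCoord (D.extSection t 1 (ψ (some (core D.input)))) (some a, i)) →
      (∀ i, (D.link t).InAnalyticIdeal (D.linkPos t) (D.extSection t 1 0) fun ψ =>
        realCoord ψ (some b, i) -
          realCoord (D.extSection t 1 (ψ (some (core D.input)))) (some b, i)) →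
      ∀ i, (D.link t).InAnalyticIdeal (D.linkPos t) (D.extSection t 1 0) fun ψ =>
        realCoord ψ (some w, i) -
          realCoord (D.extSection t 1 (ψ (some (core D.input)))) (some w, i) := by
    intro w a b ha hb hc ia ib
    have hedge : ∀ a, D.graph.Adj w a → ∀ᶠ z in 𝓝 0,
        ‖D.extSection t 1 z (some w) - D.extSection t 1 z (some a)‖ =
          (D.link t).len s(some w, some a) := by
      intro a ha
      filter_upwards [hnorm] with z hz
      exact norm_sub_eq_of_adj (isRealization_section (inLens_input hz) 1) ha
    refine MarkedLinkage.InAnalyticIdeal.of_adj_of_adj (P := some (core D.input))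
      (γ := fun o z => D.extSection t 1 z o) ?_ ?_ (link_adj.2 ha) (link_adj.2 hb) ?_ ?_ hc ia ib
    · rw [h0]; exact han
    · rw [h0]; exact fun _ => rfl
    · rw [h0]; exact hedge a ha
    · rw [h0]; exact hedge b hb
  have hcore : ∀ v i, (D.link t).InAnalyticIdeal (D.linkPos t) (D.extSection t 1 0) fun ψ =>
      realCoord ψ (some (core v), i) -
        realCoord (D.extSection t 1 (ψ (some (core D.input)))) (some (core v), i) := by
    intro v
    induction hn : D.rank v using Nat.strong_induction_on generalizing v with
    | _ n ih =>
      intro i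
      by_cases h1 : v = D.input
      · subst h1
        refine MarkedLinkage.InAnalyticIdeal.zero.congr (.of_eq (funext fun ψ => ?_))
        fin_cases i <;> simp [realCoord, extSection_input]
      by_cases h2 : v ∈ D.anchors
      · exact hfix _ (Or.inr ⟨_, Or.inl ⟨v, h2, rfl⟩, rfl⟩) i
      exact hcirc _ _ _ (Joins.fst v h1 h2).adj (Joins.snd v h1 h2).adj
        (cross_pos_ne h1 h2 norm_zero_lt) (ih _ (hn ▸ D.rank_fst v h1 h2) _ rfl)
        (ih _ (hn ▸ D.rank_snd v h1 h2) _ rfl) i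
  have hcen : ∀ k i, (D.link t).InAnalyticIdeal (D.linkPos t) (D.extSection t 1 0) fun ψ =>
      realCoord ψ (some (center k), i) -
        realCoord (D.extSection t 1 (ψ (some (core D.input)))) (some (center k), i) :=
    fun k => hfix _ (Or.inr ⟨_, Or.inr ⟨k, rfl⟩, rfl⟩)
  obtain ⟨_ | v | k | k, i⟩ := c
  · exact hfix none (Or.inl rfl) i
  · exact hcore v i
  · exact hcen k i
  · refine hcirc _ _ _ (Joins.center k).adj (Joins.tip k).adj ?_ (hcen k) (hcore k.1) i
    refine cross_elbowPos_ne_zero (norm_pos_sub_cenPos_lt ?_ k)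
      ((inLens_pos inLens_zero k.1).ne_cenPos k.2)
    exact norm_sub_cenPos_lt (by simpa [D.mid_input] using D.rad_pos D.input)

theorem isFunctionalFor_link (D : Design V) (t : ℂ) (v : V) :
    (D.link t).IsFunctionalFor (D.linkPos t) (fun _ : Fin 1 => some (core D.input))
      (fun _ : Fin 1 => some (core v)) (fun x _ => D.pos v (x 0)) (fun _ => 0) where
  domain := by
    refine ⟨0, mem_interior.2 ⟨{x | ‖x 0‖ < D.rad D.input}, ?_, ?_, ?_⟩⟩
    · intro x hx
      refine ⟨D.extSection t 1 (x 0), extSection_mem (inLens_input hx) 1, funext fun i => ?_⟩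
      rw [Subsingleton.elim i 0]
      exact extSection_input (t := t) 1 _
    · exact isOpen_lt (continuous_norm.comp (continuous_apply 0)) continuous_const
    · simpa using D.rad_pos _
  covering := ⟨_, isRegularBranchedCovering_link D t⟩
  regular := by
    have hp : positions (fun _ : Fin 1 => some (core D.input)) (D.extSection t 1 0) = fun _ => 0 :=
      funext fun _ => extSection_input (t := t) 1 0
    refine ⟨D.extSection t 1 0, ⟨extSection_mem inLens_zero 1, fun x => D.extSection t 1 (x 0),
      ?_, ?_, ?_, fun c => inAnalyticIdeal_link t c⟩, hp⟩
    · rw [hp]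
      have h0 : AnalyticAt ℝ (fun x : Fin 1 → ℂ => x 0) fun _ => 0 :=
        (ContinuousLinearMap.proj (R := ℝ) (φ := fun _ : Fin 1 => ℂ) 0).analyticAt _
      refine AnalyticAt.pi (f := fun o (x : Fin 1 → ℂ) => D.extSection t 1 (x 0) o) ?_
      rintro (_ | x)
      · exact analyticAt_const
      · exact AnalyticAt.fun_comp (g := fun z => D.section_ 1 z x)
          (analyticAt_section (by simpa using D.rad_pos _) 1 x) h0
    · rw [hp]
    · rw [hp]
      have : IsOpen {x : Fin 1 → ℂ | ‖x 0‖ < D.rad D.input} :=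
        isOpen_lt (continuous_norm.comp (continuous_apply 0)) continuous_const
      filter_upwards [this.mem_nhds (by simpa using D.rad_pos _)] with x hx
      refine ⟨extSection_mem (inLens_input hx) 1, funext fun i => ?_⟩
      rw [Subsingleton.elim i 0]
      exact extSection_input (t := t) 1 _
  output φ hφ := funext fun _ => (mem_config_link.1 hφ).1.core_eq v

end Design

namespace Design

variable {V : Type}

/-! ### The closed linkage of a design -/

/-- The fixed vertices of the closed linkage. -/
def closedFixed (D : Design V) (v : V) : Set (Vert V) := insert (core v) D.fixedVerts

variable {D : Design V} {v : V} {t : ℂ}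

theorem core_notMem_fixedVerts (hv : v ∉ D.anchors) : core v ∉ D.fixedVerts := by
  rintro (⟨w, hw, h⟩ | ⟨k, h⟩)
  · exact hv (Sum.inl.inj h ▸ hw)
  · cases h

/-- The side of its bar on which an elbow lies. -/
noncomputable def side (φ : Vert V → ℂ) (k : V × Bool) : ℝ :=
  cross (φ (core k.1) - φ (center k)) (φ (elbow k) - φ (center k))

theorem continuous_side (k : V × Bool) : Continuous fun φ : Vert V → ℂ => side φ k := by
  unfold side cross
  fun_prop

theorem side_section (s : V × Bool → ℤˣ) {z : ℂ} (hz : ‖z‖ < D.rad D.input) (k : V × Bool) :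
    ∃ r : ℝ, 0 < r ∧ side (D.section_ s z) k = (s k : ℤ) * r := by
  have hl := inLens_input hz
  have hne := (inLens_pos hl k.1).ne_cenPos k.2
  have hx := Real.sqrt_pos.2 (elbow_radicand_pos (norm_pos_sub_cenPos_lt
    (norm_sub_cenPos_lt (by simpa [D.mid_input] using hz)) k) hne)
  have hd : 0 < Complex.normSq (D.pos k.1 z - D.cenPos k) :=
    Complex.normSq_pos.2 (sub_ne_zero.2 hne)
  refine ⟨_, mul_pos hx hd, ?_⟩
  set x := √((3 / 2 * D.rad k.1) ^ 2 / ‖D.pos k.1 z - D.cenPos k‖ ^ 2 - 1 / 4) with hxdef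
  have e1 : D.section_ s z (core k.1) - D.section_ s z (center k) =
    1 * (D.pos k.1 z - D.cenPos k) := (one_mul _).symm
  have e2 : D.section_ s z (elbow k) - D.section_ s z (center k) =
      (1 / 2 + ((s k : ℤ) * x : ℝ) * Complex.I) * (D.pos k.1 z - D.cenPos k) := by
    change elbowPos _ _ _ _ - D.cenPos k = _
    rw [elbowPos, ← hxdef]
    push_cast
    ring
  rw [side, e1, e2, cross_mul_mul, ← mul_assoc]
  congr 1
  simp only [cross]
  simp

/-- Since all elbows are properly bent here, the signs can be recovered from strict inequalities
between continuous functions. This makes the sheets open and disjoint. -/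
theorem side_section_pos_iff (s s' : V × Bool → ℤˣ) {z : ℂ} (hz : ‖z‖ < D.rad D.input) :
    (∀ k, 0 < (s' k : ℤ) * side (D.section_ s z) k) ↔ s = s' := by
  constructor
  · intro h
    funext k
    obtain ⟨r, hr, e⟩ := side_section s hz k
    have := h k
    rw [e] at this
    rcases Int.units_eq_one_or (s k) with h1 | h1 <;>
      rcases Int.units_eq_one_or (s' k) with h2 | h2 <;> simp [h1, h2] at this ⊢ <;> linarith
  · rintro rfl k
    obtain ⟨r, hr, e⟩ := side_section s hz k
    rw [e, ← mul_assoc, ← sq, units_cast_sq, one_mul]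
    exact hr

variable [Fintype V]

/-- The linkage of a design with an additional fixed vertex `v`. -/
noncomputable def closedLink (D : Design V) (v : V) :
    MarkedLinkage (Vert V) (Nat.card (D.closedFixed v)) :=
  linkageOf D.graph D.base (fun _ _ => base_ne_of_adj) (D.closedFixed v)

open Classical in
/-- The positions of the fixed vertices of `closedLink`: the vertex `v` is fixed at `t`. -/
noncomputable def closedPos (D : Design V) (v : V) (t : ℂ) (j : Fin (Nat.card (D.closedFixed v))) :
    ℂ :=
  Function.update D.base (core v) t ((D.closedLink v).mark j)

theorem mem_config_closedLink (hv : v ∉ D.anchors) {φ : Vert V → ℂ} :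
    φ ∈ (D.closedLink v).config (D.closedPos v t) ↔ D.IsRealization φ ∧ φ (core v) = t := by
  classical
  refine (mem_config_linkageOf (pos := Function.update D.base (core v) t)).trans ?_
  have hne : ∀ x ∈ D.fixedVerts, x ≠ core v := fun x hx h =>
    core_notMem_fixedVerts hv (h ▸ hx)
  rw [isRealization_iff, and_assoc, closedFixed, Set.forall_mem_insert, Function.update_self,
    and_comm (a := φ (core v) = t)]
  refine and_congr_right fun _ => and_congr_left fun _ => forall₂_congr fun x hx => ?_
  rw [Function.update_of_ne (hne x hx)]

theorem section_mem_closed (hv : v ∉ D.anchors) {z : ℂ} (hz : D.InLens D.input z)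
    (ht : D.pos v z = t) (s : V × Bool → ℤˣ) :
    D.section_ s z ∈ (D.closedLink v).config (D.closedPos v t) :=
  (mem_config_closedLink hv).2 ⟨isRealization_section hz s, ht⟩

/-- The output vertex is glued to the isolated fixed vertex at `t`, whose only purpose is this
identification. -/
theorem isSelfFiberSum_closedLink (hv : v ∉ D.anchors) :
    (D.link t).IsSelfFiberSum (D.linkPos t) {some (core v)} (fun _ => none) (D.closedLink v)
      (D.closedPos v t) (fun o => o.elim (core v) id) where
  surjective x := ⟨some x, rfl⟩
  identify x y := by
    constructor
    · intro h
      have h1 : Relation.EqvGen (fun a b : Option (Vert V) => a ∈ ({some (core v)} : Set _) ∧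
          b = none) (some (core v)) none := .rel _ _ ⟨rfl, rfl⟩
      rcases x with _ | x <;> rcases y with _ | y
      · exact .refl _
      · obtain rfl : core v = y := h
        exact h1.symm
      · obtain rfl : x = core v := h
        exact h1
      · obtain rfl : x = y := h
        exact .refl _
    · intro h
      induction h with
      | rel a b h =>
        obtain ⟨rfl, rfl⟩ := h
        rfl
      | refl => rfl
      | symm _ _ _ ih => exact ih.symm
      | trans _ _ _ _ _ ih1 ih2 => exact ih1.trans ih2
  adj x y := by
    constructor
    · exact fun h => ⟨some x, some y, link_adj.2 h, rfl, rfl⟩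
    · rintro ⟨a, b, h, rfl, rfl⟩
      obtain ⟨a, b, h', rfl, rfl⟩ := link_adj_iff.1 h
      exact h'
  len a b h := by
    obtain ⟨a, b, -, rfl, rfl⟩ := link_adj_iff.1 h
    rfl
  mark := by
    have h1 : Set.range (D.link t).mark = _ := range_linkageOf_mark
    have h2 : Set.range (D.closedLink v).mark = _ := range_linkageOf_mark
    rw [h1, h2, Set.image_insert_eq, Set.image_image]
    simp [closedFixed]
  image i j h := by
    classical
    rw [closedPos, linkPos, h]
    have hi : (D.link t).mark i ∈ (insert none (some '' D.fixedVerts) : Set _) :=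
      linkageOf_mark_mem i
    rcases hi with hi | ⟨x, hx, hi⟩
    · rw [hi]
      exact Function.update_self _ _ _
    · rw [← hi]
      refine Function.update_of_ne (fun h => core_notMem_fixedVerts hv ?_) _ _
      have h' : x = core v := h
      rwa [h'] at hx

theorem isClosedFunctional_closedLink (hv : v ∉ D.anchors) :
    (D.closedLink v).IsClosedFunctional (D.closedPos v t) (fun _ : Fin 1 => core D.input) := by
  refine ⟨_, inferInstance, _, 1, D.link t, D.linkPos t, _, fun _ => some (core v), _, _,
    {some (core v)}, fun _ => none, _, isFunctionalFor_link D t v, ⟨_, rfl⟩, ?_, ?_,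
    isSelfFiberSum_closedLink hv, rfl⟩
  · rintro _ rfl
    exact ⟨0, rfl⟩
  · intro _ _
    obtain ⟨j, hj⟩ : ∃ j, (D.link t).mark j = none := exists_linkageOf_mark (Or.inl rfl)
    exact ⟨j, hj⟩

theorem flip_mem_closed (hv : v ∉ D.anchors) (τ : V × Bool → ℤˣ) (φ : Vert V → ℂ)
    (hφ : φ ∈ (D.closedLink v).config (D.closedPos v t)) :
    (hooks V).flip τ φ ∈ (D.closedLink v).config (D.closedPos v t) := by
  obtain ⟨h, ht⟩ := (mem_config_closedLink hv).1 hφ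
  obtain ⟨s, hs⟩ := h.exists_eq_section
  have hl := h.inLens D.input
  generalize φ (core D.input) = z at hs hl
  subst hs
  rw [hooks_flip_section]
  exact section_mem_closed hv hl ht _

theorem isAnalyticallyTrivial_closedLink (hv : v ∉ D.anchors) {Γ U : Set ℂ}
    (hΓ : ∀ z, ‖z‖ < 3 * D.rad D.input → (D.pos v z = t ↔ z ∈ Γ)) (hU : U ⊆ Γ)
    (hball : ∀ z ∈ U, ‖z‖ < D.rad D.input) :
    IsAnalyticallyTrivialPolynomialCovering ((D.closedLink v).config (D.closedPos v t))
      (core D.input) Γ U := by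
  classical
  have hsec : ∀ s, ∀ z ∈ U, D.section_ s z ∈ (D.closedLink v).config (D.closedPos v t) :=
    fun s z hz => section_mem_closed hv (inLens_input (hball z hz))
      ((hΓ z (inLens_input (hball z hz)).norm_input_lt).2 (hU hz)) s
  have hex : ∀ φ ∈ (D.closedLink v).config (D.closedPos v t),
      ∃ s, φ = D.section_ s (φ (core D.input)) := fun φ hφ =>
    ((mem_config_closedLink hv).1 hφ).1.exists_eq_section
  have hin : ∀ s z, D.section_ s z (core D.input) = z := fun s z => D.pos_input z
  refine ⟨?_, ?_, ?_⟩
  · intro φ hφ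
    obtain ⟨h, ht⟩ := (mem_config_closedLink hv).1 hφ
    rw [h.core_eq] at ht
    exact (hΓ _ h.norm_input_lt).1 ht
  · let e := Fintype.equivFin (V × Bool → ℤˣ)
    have hS : ∀ s, D.section_ s '' U = {φ : Vert V → ℂ | ∀ k, 0 < (s k : ℤ) * side φ k} ∩
        {φ ∈ (D.closedLink v).config (D.closedPos v t) | φ (core D.input) ∈ U} := by
      intro s
      ext φ
      constructor
      · rintro ⟨z, hz, rfl⟩
        refine ⟨(side_section_pos_iff s s (hball z hz)).2 rfl, hsec s z hz, ?_⟩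
        rwa [hin]
      · rintro ⟨hs, hφ, hz⟩
        obtain ⟨s', hs'⟩ := hex φ hφ
        rw [Set.mem_ofPred_eq, hs'] at hs
        obtain rfl := (side_section_pos_iff s' s (hball _ hz)).1 hs
        exact ⟨_, hz, hs'.symm⟩
    refine ⟨_, fun i => D.section_ (e.symm i) '' U, Fintype.card_pos, ?_, ?_, ?_, ?_⟩
    · ext φ
      simp only [Set.mem_iUnion]
      constructor
      · rintro ⟨i, h⟩
        rw [hS] at h
        exact h.2
      · rintro ⟨hφ, hz⟩
        obtain ⟨s, hs⟩ := hex φ hφ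
        exact ⟨e s, _, hz, by rw [e.symm_apply_apply, ← hs]⟩
    · intro i j hij
      refine Set.disjoint_left.2 ?_
      rintro _ ⟨z, hz, rfl⟩ ⟨z', hz', h⟩
      obtain rfl : z' = z := by rw [← hin (e.symm j) z', h, hin]
      have := (side_section_pos_iff (e.symm j) (e.symm j) (hball _ hz)).2 rfl
      rw [h] at this
      exact hij (e.symm.injective ((side_section_pos_iff _ _ (hball _ hz)).1 this))
    · refine fun i => ⟨_, ?_, hS _⟩
      rw [Set.ofPred_forall]
      exact isOpen_iInter_of_finite fun k =>
        isOpen_lt continuous_const (continuous_const.mul (continuous_side k))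
    · intro i
      have hinv : Set.InvOn (D.section_ (e.symm i)) (fun φ : Vert V → ℂ => φ (core D.input))
          (D.section_ (e.symm i) '' U) U := by
        refine ⟨?_, fun z _ => hin _ z⟩
        rintro _ ⟨z, -, rfl⟩
        simp only [hin]
      refine ⟨hinv.bijOn ?_ (Set.mapsTo_image _ _), ?_, _, hinv, ?_⟩
      · rintro _ ⟨z, hz, rfl⟩
        simpa only [hin] using hz
      · exact fun φ _ => ⟨_, (ContinuousLinearMap.proj (R := ℝ) (φ := fun _ : Vert V => ℂ)
          (core D.input)).analyticAt φ, .of_forall fun _ => rfl⟩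
      · exact fun z hz => ⟨D.section_ (e.symm i), AnalyticAt.pi
          (f := fun x z => D.section_ (e.symm i) z x)
          (fun x => analyticAt_section (hball z hz) _ x), .of_forall fun _ => rfl⟩
  · let ρ := (hooks V).flipHom _ (flip_mem_closed (t := t) hv)
    refine ⟨ρ.range, Finite.of_surjective _ (MonoidHom.rangeRestrict_surjective ρ), ?_, ?_⟩
    · rintro _ ⟨τ, rfl⟩
      exact ⟨(hooks V).isPolynomialMap_flipHom _ τ, fun φ => rfl⟩
    · intro φ ψ hφ h
      obtain ⟨s, hs⟩ := hex φ φ.2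
      obtain ⟨s', hs'⟩ := hex ψ ψ.2
      rw [← h] at hs'
      have hρ : ∀ τ, ρ τ φ = ψ ↔ τ = s' * s⁻¹ := by
        intro τ
        rw [Subtype.ext_iff, Elbows.coe_flipHom, hs, hooks_flip_section, hs', eq_mul_inv_iff_mul_eq]
        constructor
        · intro h
          refine (side_section_pos_iff (D := D) _ _ (hball _ hφ)).1 ?_
          rw [h]
          exact (side_section_pos_iff (D := D) _ _ (hball _ hφ)).2 rfl
        · rintro rfl
          rfl
      refine ⟨ρ (s' * s⁻¹), ⟨⟨_, rfl⟩, (hρ _).2 rfl⟩, ?_⟩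
      rintro _ ⟨⟨τ, rfl⟩, h⟩
      rw [(hρ τ).1 h]

end Design

/-! ### Designs of traceable functions -/

/-- The least number of generations in which `w` can be constructed. -/
noncomputable def generation (w : ℂ × ℝ → ℂ) : ℕ := sInf {n | TraceableAt n w}

/-- A set of functions each of which is a coordinate, a function of the second coordinate, or
constructed from members of the set of lower generation. -/
def IsTraceClosed (S : Set (ℂ × ℝ → ℂ)) : Prop :=
  ∀ w ∈ S, w = Prod.fst ∨ (∃ k : ℝ → ℂ, AnalyticAt ℝ k 0 ∧ w = fun p => k p.2) ∨
    ∃ a ∈ S, ∃ b ∈ S, generation a < generation w ∧ generation b < generation w ∧ IsCircle w a b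

theorem IsTraceClosed.union {S T : Set (ℂ × ℝ → ℂ)} (hS : IsTraceClosed S) (hT : IsTraceClosed T) :
    IsTraceClosed (S ∪ T) := by
  rintro w (hw | hw)
  · rcases hS w hw with h | h | ⟨a, ha, b, hb, h⟩
    exacts [Or.inl h, Or.inr (Or.inl h), Or.inr (Or.inr ⟨a, Or.inl ha, b, Or.inl hb, h⟩)]
  · rcases hT w hw with h | h | ⟨a, ha, b, hb, h⟩
    exacts [Or.inl h, Or.inr (Or.inl h), Or.inr (Or.inr ⟨a, Or.inr ha, b, Or.inr hb, h⟩)]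

/-- The generation of a function is intrinsic, so the families for the two parents can be united
without renumbering. -/
theorem TraceableAt.exists_isTraceClosed {n : ℕ} {w : ℂ × ℝ → ℂ} (h : TraceableAt n w) :
    ∃ S : Set (ℂ × ℝ → ℂ), S.Finite ∧ w ∈ S ∧ IsTraceClosed S := by
  induction n generalizing w with
  | zero =>
    refine ⟨{w}, Set.finite_singleton w, rfl, ?_⟩
    rintro _ rfl
    rcases h with h | h
    exacts [Or.inl h, Or.inr (Or.inl h)]
  | succ n ih =>
    -- If `w` is not obtained in `n` generations, its generation exceeds `n`, hence those of both
    -- parents.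
    by_cases hn : TraceableAt n w
    · exact ih hn
    rcases h with h | ⟨a, b, ha, hb, hc⟩
    · exact ih h
    obtain ⟨S, fS, aS, cS⟩ := ih ha
    obtain ⟨T, fT, bT, cT⟩ := ih hb
    have hw : n < generation w := by
      by_contra! hle
      have hne : {m | TraceableAt m w}.Nonempty := ⟨n + 1, Or.inr ⟨a, b, ha, hb, hc⟩⟩
      exact hn ((Nat.sInf_mem hne).mono hle)
    have hla : generation a ≤ n := Nat.sInf_le ha
    have hlb : generation b ≤ n := Nat.sInf_le hb
    refine ⟨insert w (S ∪ T), (fS.union fT).insert w, Set.mem_insert _ _, ?_⟩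
    rintro v (rfl | hv)
    · exact Or.inr (Or.inr ⟨a, Or.inr (Or.inl aS), b, Or.inr (Or.inr bT), hla.trans_lt hw,
        hlb.trans_lt hw, hc⟩)
    · rcases cS.union cT v hv with h | h | ⟨a, ha, b, hb, h⟩
      exacts [Or.inl h, Or.inr (Or.inl h), Or.inr (Or.inr ⟨a, Or.inr ha, b, Or.inr hb, h⟩)]

theorem cross_div_div (l : ℝ) (x y : ℂ) : cross (x / l) (y / l) = cross x y / l ^ 2 := by
  simp only [cross, Complex.div_ofReal_re, Complex.div_ofReal_im]
  ring

/-- Transversality at 0 persists when `p` and a second candidate position `y` vary independently.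
The radius `3 * ε` is that of the disk containing the lens of hooks of size `ε`. -/
theorem IsCircle.exists_tolerance {w a b : ℂ × ℝ → ℂ} (h : IsCircle w a b) (ha : AnalyticAt ℝ a 0)
    (hb : AnalyticAt ℝ b 0) : ∃ ε > 0, ∀ᶠ p in 𝓝 0, AnalyticAt ℝ w p ∧ ‖w p - w 0‖ < ε ∧
      ‖w p - a p‖ = ‖w 0 - a 0‖ ∧ ‖w p - b p‖ = ‖w 0 - b 0‖ ∧
      ∀ y, ‖y - w 0‖ < 3 * ε → cross (w p - a p + (y - a p)) (w p - b p + (y - b p)) ≠ 0 := by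
  have hwc := h.analytic.continuousAt
  have hcont : ContinuousAt (fun q : (ℂ × ℝ) × ℂ =>
      cross (w q.1 - a q.1 + (q.2 - a q.1)) (w q.1 - b q.1 + (q.2 - b q.1))) (0, w 0) := by
    have h1 : ContinuousAt (fun q : (ℂ × ℝ) × ℂ => w q.1) (0, w 0) :=
      ContinuousAt.comp (g := w) hwc continuousAt_fst
    have h2 : ContinuousAt (fun q : (ℂ × ℝ) × ℂ => a q.1) (0, w 0) :=
      ContinuousAt.comp (g := a) ha.continuousAt continuousAt_fst
    have h3 : ContinuousAt (fun q : (ℂ × ℝ) × ℂ => b q.1) (0, w 0) :=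
      ContinuousAt.comp (g := b) hb.continuousAt continuousAt_fst
    unfold cross
    fun_prop
  have hne : cross (w 0 - a 0 + (w 0 - a 0)) (w 0 - b 0 + (w 0 - b 0)) ≠ 0 := by
    have := h.cross_ne
    contrapose! this
    simp [cross] at this ⊢
    linarith
  have hev := hcont.eventually_ne hne
  rw [nhds_prod_eq] at hev
  obtain ⟨p1, h1, p2, h2, h12⟩ := eventually_prod_iff.1 hev
  obtain ⟨δ, hδ, hball⟩ := Metric.eventually_nhds_iff.1 h2
  refine ⟨δ / 3, by positivity, ?_⟩
  have hnear : ∀ᶠ p in 𝓝 0, ‖w p - w 0‖ < δ / 3 := by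
    filter_upwards [hwc.eventually (Metric.ball_mem_nhds (w 0) (by positivity : 0 < δ / 3))]
      with p hp
    rwa [← dist_eq_norm]
  filter_upwards [h.analytic.eventually_analyticAt, hnear, h.left, h.right, h1] with p c1 c2 c3 c4 c5
  refine ⟨c1, c2, c3, c4, fun y hy => h12 c5 (hball ?_)⟩
  rw [dist_eq_norm]
  linarith

/-- A system of circle intersections is realized, for a small scale `l`, by a design. -/
theorem exists_design {V : Type} [Finite V] (H : V → ℂ × ℝ → ℂ) (P : V) (A : Set V)
    (fst snd : V → V) (rank : V → ℕ) (hP : H P = Prod.fst) (hPA : P ∉ A)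
    (hH : ∀ v, AnalyticAt ℝ (H v) 0)
    (hA : ∀ v ∈ A, ∃ k : ℝ → ℂ, H v = fun p => k p.2)
    (hfst : ∀ v, v ≠ P → v ∉ A → rank (fst v) < rank v)
    (hsnd : ∀ v, v ≠ P → v ∉ A → rank (snd v) < rank v)
    (hc : ∀ v, v ≠ P → v ∉ A → IsCircle (H v) (H (fst v)) (H (snd v))) {R : ℝ} (hR : 0 < R) :
    ∃ l : ℝ, 0 < l ∧ ∃ D : Design V, D.input = P ∧ D.anchors = A ∧ D.rad P = R ∧
      ∀ v z, D.pos v z = H v (l * z, l) / l := by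
  classical
  have htol : ∀ v, ∃ ε > 0, v ≠ P → v ∉ A → ∀ᶠ p in 𝓝 0, AnalyticAt ℝ (H v) p ∧
      ‖H v p - H v 0‖ < ε ∧ ‖H v p - H (fst v) p‖ = ‖H v 0 - H (fst v) 0‖ ∧
      ‖H v p - H (snd v) p‖ = ‖H v 0 - H (snd v) 0‖ ∧ ∀ y, ‖y - H v 0‖ < 3 * ε →
        cross (H v p - H (fst v) p + (y - H (fst v) p))
          (H v p - H (snd v) p + (y - H (snd v) p)) ≠ 0 := by
    intro v
    by_cases hv : v ≠ P ∧ v ∉ A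
    · obtain ⟨ε, hε, h⟩ := (hc v hv.1 hv.2).exists_tolerance (hH _) (hH _)
      exact ⟨ε, hε, fun _ _ => h⟩
    · exact ⟨1, one_pos, fun h1 h2 => absurd ⟨h1, h2⟩ hv⟩
  choose ε hε hev using htol
  have hall := eventually_all.2 fun v => eventually_imp_distrib_left.2 fun h1 =>
    eventually_imp_distrib_left.2 (hev v h1)
  obtain ⟨δ, hδ, hball⟩ := Metric.eventually_nhds_iff.1 hall
  -- Both `l * (3 * R)` and `l` must be smaller than `δ`.
  set l := δ / (3 * R + 2) with hl
  have hl0 : 0 < l := by positivity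
  have hlc : (l : ℂ) ≠ 0 := by exact_mod_cast hl0.ne'
  have hlδ : l * (3 * R + 2) = δ := by rw [hl]; field_simp
  have hmem : ∀ z : ℂ, ‖z‖ < 3 * R → dist ((l * z, l) : ℂ × ℝ) 0 < δ := by
    intro z hz
    rw [dist_zero_right, Prod.norm_mk, norm_mul, Complex.norm_real, Real.norm_of_nonneg hl0.le,
      max_lt_iff, ← hlδ]
    constructor <;> nlinarith
  have key := fun z hz v h1 h2 => hball (hmem z hz) v h1 h2
  have hdist : ∀ v w, (∀ z : ℂ, ‖z‖ < 3 * R →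
      ‖H v (l * z, l) - H w (l * z, l)‖ = ‖H v 0 - H w 0‖) → ∀ z : ℂ, ‖z‖ < 3 * R →
      ‖H v (l * z, l) / l - H w (l * z, l) / l‖ = ‖H v (l * 0, l) / l - H w (l * 0, l) / l‖ := by
    intro v w h z hz
    rw [← sub_div, ← sub_div, norm_div, norm_div, h z hz, h 0 (by simpa using hR)]
  refine ⟨l, hl0, {
    input := P
    pos := fun v z => H v (l * z, l) / l
    anchors := A
    fst := fst
    snd := snd
    rank := rank
    -- The disk of an anchor is centered at its exact position for the scale `l`; that of a circle
    -- vertex at the value at 0, with the tolerance rescaled.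
    mid := fun v => if v = P then 0 else if v ∈ A then H v (0, l) / l else H v 0 / l
    rad := fun v => if v = P then R else ε v / l
    rad_pos := fun v => ?_
    pos_input := fun z => ?_
    mid_input := if_pos rfl
    analyticAt := fun v z hz => ?_
    pos_anchor := fun v hv z hz => ?_
    near := fun v z hv hz => ?_
    rank_fst := hfst
    rank_snd := hsnd
    dist_fst := fun v h1 h2 z hz => ?_
    dist_snd := fun v h1 h2 z hz => ?_
    cross_ne := fun v h1 h2 z w hz hw => ?_ }, rfl, rfl, if_pos rfl, fun v z => rfl⟩
  · split_ifs
    exacts [hR, div_pos (hε v) hl0]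
  · rw [hP]; field_simp
  · rw [if_pos rfl] at hz
    have hmul : AnalyticAt ℝ (fun z : ℂ => (l : ℂ) * z) z := by fun_prop
    by_cases h1 : v = P
    · rw [h1, hP]
      exact hmul.div analyticAt_const hlc
    by_cases h2 : v ∈ A
    · obtain ⟨k, hk⟩ := hA v h2
      have e : (fun z : ℂ => H v (l * z, l) / (l : ℂ)) = fun _ => k l / (l : ℂ) := by rw [hk]
      change AnalyticAt ℝ (fun z : ℂ => H v (l * z, l) / (l : ℂ)) z
      rw [e]
      exact analyticAt_const
    · have hlin : AnalyticAt ℝ (fun z : ℂ => ((l * z, l) : ℂ × ℝ)) z :=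
        hmul.prod analyticAt_const
      exact (AnalyticAt.fun_comp (g := H v) (f := fun z : ℂ => ((l * z, l) : ℂ × ℝ))
        (key z hz v h1 h2).1 hlin).div analyticAt_const hlc
  · rw [if_neg (ne_of_mem_of_not_mem hv hPA), if_pos hv]
    obtain ⟨k, hk⟩ := hA v hv
    rw [hk]
  · rw [if_pos rfl] at hz
    rw [if_neg hv, if_neg hv]
    by_cases h2 : v ∈ A
    · obtain ⟨k, hk⟩ := hA v h2
      rw [if_pos h2, hk, sub_self, norm_zero]
      exact div_pos (hε v) hl0
    · rw [if_neg h2, ← sub_div, norm_div, Complex.norm_real, Real.norm_of_nonneg hl0.le]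
      exact div_lt_div_of_pos_right (key z hz v hv h2).2.1 hl0
  · rw [if_pos rfl] at hz
    exact hdist _ _ (fun z hz => (key z hz v h1 h2).2.2.1) z hz
  · rw [if_pos rfl] at hz
    exact hdist _ _ (fun z hz => (key z hz v h1 h2).2.2.2.1) z hz
  · rw [if_pos rfl] at hz
    rw [if_neg h1, if_neg h1, if_neg h2] at hw
    have hy : ‖l * w - H v 0‖ < 3 * ε v := by
      have e : l * w - H v 0 = l * (w - H v 0 / l) := by field_simp
      rw [e, norm_mul, Complex.norm_real, Real.norm_of_nonneg hl0.le]
      calc l * ‖w - H v 0 / l‖ < l * (3 * (ε v / l)) := mul_lt_mul_of_pos_left hw hl0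
        _ = 3 * ε v := by field_simp
    have := (key z hz v h1 h2).2.2.2.2 _ hy
    have e : ∀ u, H v (l * z, l) / l - H u (l * z, l) / l + (w - H u (l * z, l) / l) =
        (H v (l * z, l) - H u (l * z, l) + (l * w - H u (l * z, l))) / l := fun u => by
      field_simp
    rw [e, e, cross_div_div]
    exact div_ne_zero this (by positivity)

/-- Every function constructed by a circle intersection is realized, at a small scale, by a vertex
of a design which is not an anchor. -/
theorem IsCircle.exists_design {w a b : ℂ × ℝ → ℂ} (h : IsCircle w a b) (ha : Traceable a)
    (hb : Traceable b) {R : ℝ} (hR : 0 < R) : ∃ (V : Type) (_ : Fintype V) (D : Design V) (v : V)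
      (l : ℝ), 0 < l ∧ v ∉ D.anchors ∧ D.rad D.input = R ∧ ∀ z, D.pos v z = w (l * z, l) / l := by
  classical
  obtain ⟨n, hn⟩ := ha
  obtain ⟨m, hm⟩ := hb
  obtain ⟨S, fS, aS, cS⟩ := hn.exists_isTraceClosed
  obtain ⟨T, fT, bT, cT⟩ := hm.exists_isTraceClosed
  have cI : IsTraceClosed {Prod.fst} := fun v hv => Or.inl hv
  set W : Set (ℂ × ℝ → ℂ) := (S ∪ T) ∪ {Prod.fst} with hW
  have cW : IsTraceClosed W := (cS.union cT).union cI
  have fW : W.Finite := (fS.union fT).union (Set.finite_singleton _)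
  have := fW.fintype
  let A₀ : Set W := {v | v.1 ≠ Prod.fst ∧ ∃ k : ℝ → ℂ, AnalyticAt ℝ k 0 ∧ v.1 = fun p => k p.2}
  have hpar : ∀ v : W, ∃ c d : W, v.1 ≠ Prod.fst → v ∉ A₀ →
      generation c.1 < generation v.1 ∧ generation d.1 < generation v.1 ∧ IsCircle v.1 c.1 d.1 := by
    intro v
    by_cases hv : v.1 ≠ Prod.fst ∧ v ∉ A₀
    · rcases cW v.1 v.2 with h | h | ⟨c, hc, d, hd, h⟩
      · exact absurd h hv.1
      · exact absurd ⟨hv.1, h⟩ hv.2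
      · exact ⟨⟨c, hc⟩, ⟨d, hd⟩, fun _ _ => h⟩
    · exact ⟨v, v, fun h1 h2 => absurd ⟨h1, h2⟩ hv⟩
  choose c d hcd using hpar
  obtain ⟨N, hN⟩ : ∃ N, ∀ v : W, generation v.1 < N := by
    obtain ⟨N, hN⟩ := (Set.finite_range fun v : W => generation v.1).bddAbove
    exact ⟨N + 1, fun v => Nat.lt_succ_of_le (hN ⟨v, rfl⟩)⟩
  let P : W := ⟨Prod.fst, Or.inr rfl⟩
  have hP : ∀ v : W, some v ≠ some P → v.1 ≠ Prod.fst := fun v hv h =>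
    hv (congrArg some (Subtype.ext h))
  have hA : ∀ v : W, some v ∉ some '' A₀ → v ∉ A₀ := fun v hv h => hv ⟨v, h, rfl⟩
  have hanalytic : ∀ v : W, AnalyticAt ℝ v.1 0 := by
    intro v
    rcases cW v.1 v.2 with h | ⟨k, hk, h⟩ | ⟨_, _, _, _, _, _, hv⟩
    · rw [h]; exact Traceable.input.analyticAt
    · rw [h]; exact (Traceable.fixed hk).analyticAt
    · exact hv.analytic
  -- The vertices are the functions of the family, and `none` is a separate vertex for `w`, of
  -- largest rank `N`. So `w` is not an anchor even if it coincides with a function that is one.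
  obtain ⟨l, hl, D, hD1, hD2, hD3, hD4⟩ := _root_.exists_design (V := Option W)
    (fun o => o.elim w Subtype.val) (some P) (some '' A₀)
    (fun o => some (o.elim ⟨a, Or.inl (Or.inl aS)⟩ c))
    (fun o => some (o.elim ⟨b, Or.inl (Or.inr bT)⟩ d))
    (fun o => o.elim N fun v => generation v.1) rfl
    (by rintro ⟨v, hv, h⟩; exact hv.1 (congrArg Subtype.val (Option.some.inj h)))
    (by rintro (_ | v); exacts [h.analytic, hanalytic v])
    (by rintro _ ⟨v, ⟨-, k, -, hk⟩, rfl⟩; exact ⟨k, hk⟩)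
    (by
      rintro (_ | v) h1 h2
      exacts [hN _, (hcd v (hP v h1) (hA v h2)).1])
    (by
      rintro (_ | v) h1 h2
      exacts [hN _, (hcd v (hP v h1) (hA v h2)).2.1])
    (by
      rintro (_ | v) h1 h2
      exacts [h, (hcd v (hP v h1) (hA v h2)).2.2]) hR
  refine ⟨_, inferInstance, D, none, l, hl, ?_, ?_, fun z => hD4 none z⟩
  · rw [hD2]
    rintro ⟨v, -, h⟩
    cases h
  · rw [hD1, hD3]

/-! ### The theorem -/

theorem theoremE (f : MvPolynomial (Fin 2) ℂ) (F : ℂ → ℝ)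
    (hF : ∀ z : ℂ, MvPolynomial.eval ![z, (starRingEnd ℂ) z] f = (F z : ℂ))
    (U : Set ℂ) (hopen : ∃ N : Set ℂ, IsOpen N ∧ U = {z : ℂ | F z = 0} ∩ N)
    (hbdd : Bornology.IsBounded U) :
    ∃ (V₀ : Type) (_ : Fintype V₀) (s₀ : ℕ) (L₀ : MarkedLinkage V₀ s₀) (Z : Fin s₀ → ℂ) (P : V₀),
      L₀.IsClosedFunctional Z (fun _ : Fin 1 => P) ∧
      IsAnalyticallyTrivialPolynomialCovering (L₀.config Z) P {z : ℂ | F z = 0} U := by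
  obtain ⟨R, hR, hUR⟩ := hbdd.subset_ball_lt 0 0
  -- The translation by 1 makes the output vertex a circle intersection, even when `f` is constant.
  obtain ⟨a, b, ha, hb, h⟩ :=
    (traceable_homogenized f).exists_isCircle_add_const (c := 1) one_ne_zero
  obtain ⟨V, _, D, v, l, hl, hv, hrad, hpos⟩ := h.exists_design ha hb hR
  refine ⟨_, inferInstance, _, D.closedLink v, D.closedPos v (1 / l : ℂ), Design.core D.input,
    Design.isClosedFunctional_closedLink hv,
    Design.isAnalyticallyTrivial_closedLink hv (fun z _ => ?_) ?_ fun z hz => ?_⟩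
  -- By homogeneity the position at `z` is `(l ^ d * F z + 1) / l`, with `d` the total degree of
  -- `f`, so it is `1 / l` exactly when `F z = 0`.
  · have hlc : (l : ℂ) ≠ 0 := by exact_mod_cast hl.ne'
    rw [hpos, homogenized_mul, hF, div_left_inj' hlc, add_eq_right, mul_eq_zero]
    simp [hlc]
  · obtain ⟨N, -, rfl⟩ := hopen
    exact Set.inter_subset_left
  · rw [hrad]
    simpa using hUR hz
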